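/- Let $M(\mathbb R)$ be the set of Borel probability measures on $\mathbb R$ with the Borel $\sigma$-field of the topology of weak convergence. For $\alpha>0$ and $P_0\in M(\mathbb R)$, the Dirichlet process $DP(\alpha,P_0)$ is the law of a random element $\tilde P$ of $M(\mathbb R)$ such that, for every finite measurable partition $A_1,\dots,A_k$ of $\mathbb R$, the vector $(\tilde P(A_1),\dots,\tilde P(A_k))$ has the Dirichlet distribution with parameters $(\alpha P_0(A_1),\dots,\alpha P_0(A_k))$ (coordinates with parameter $0$ being almost surely $0$). For a measure $p$ on $\mathbb R$ write $p^-(A)=p(-A)$. The symmetrized Dirichlet process $DP_S(\alpha,P_0)$ is the law of $\frac12(\tilde P+\tilde P^-)$, where $\tilde P\sim DP(\alpha,P_0)$. Let $\alpha>0$, let $P_0\in M(\mathbb R)$, and let $P$ be a random element of $M(\mathbb R)$ with law $DP_S(\alpha,P_0)$. (i) (Conjugacy.) Let $n\ge 0$ and suppose that, given $P$, the real random variables $\theta_1,\dots,\theta_n$ are independent and identically distributed with law $P$. Then the posterior distribution of $P$ given $\theta_1,\dots,\theta_n$ is $$DP_S\Big(\alpha+n,\ \frac{\alpha P_0+\sum_{i=1}^n\delta_{\theta_i}}{\alpha+n}\Big);$$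 that is, there is a probability kernel from $\mathbb R^n$ to $M(\mathbb R)$ whose value at every $(t_1,\dots,t_n)$ is $DP_S\big(\alpha+n,(\alpha P_0+\sum_{i=1}^n\delta_{t_i})/(\alpha+n)\big)$ and which is a regular conditional distribution of $P$ given $(\theta_1,\dots,\theta_n)$. (ii) (Pólya urn rule.) Let $n\ge 0$ and suppose that, given $P$, the real random variables $\theta_1,\dots,\theta_{n+1}$ are independent and identically distributed with law $P$. Then the conditional distribution of $\theta_{n+1}$ given $\theta_1,\dots,\theta_n$ is $$\frac{\alpha}{2(\alpha+n)}\big(P_0+P_0^-\big)+\frac{1}{2(\alpha+n)}\sum_{i=1}^n\big(\delta_{\theta_i}+\delta_{-\theta_i}\big)$$ (for $n=0$ this is the marginal distribution of $\theta_1$, the sum being zero). -/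

import Mathlib

open MeasureTheory ProbabilityTheory Set Filter Topology

namespace SymDP

/-! ### The space of probability measures on the real line

`ProbabilityMeasure ℝ` carries the topology of weak convergence, and Mathlib equips it with the
`σ`-algebra generated by the evaluations `p ↦ p A`.  The facts below show that this is the Borel
`σ`-algebra of the weak topology. -/

/-- The set `{p | q < p (⋃ s ∈ F, s)}` with `q` rational and `F` a finite subfamily of a countable
basis of the line. -/
def subbasicSet (x : Finset (TopologicalSpace.countableBasis ℝ) × ℚ) :
    Set (ProbabilityMeasure ℝ) :=
  {p | ((Real.toNNReal (x.2 : ℝ) : NNReal) : ENNReal) < (p : Measure ℝ) (⋃ s ∈ x.1, (s : Set ℝ))}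

theorem measurable_eval {A : Set ℝ} (hA : MeasurableSet A) :
    Measurable (fun p : ProbabilityMeasure ℝ => (p : Measure ℝ) A) :=
  (Measure.measurable_coe hA).comp measurable_subtype_coe

/-- The topology generated by the countable family `subbasicSet`. -/
@[reducible] def subbasicTopology : TopologicalSpace (ProbabilityMeasure ℝ) :=
  TopologicalSpace.generateFrom (range subbasicSet)

theorem secondCountable_subbasicTopology :
    @SecondCountableTopology _ subbasicTopology :=
  @SecondCountableTopology.mk _ subbasicTopology ⟨range subbasicSet, countable_range _, rfl⟩

theorem nhds_subbasicTopology_le (p : ProbabilityMeasure ℝ) :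
    @nhds _ subbasicTopology p ≤ 𝓝 p := by
  have hcg : (@nhds _ subbasicTopology p).IsCountablyGenerated :=
    @FirstCountableTopology.nhds_generated_countable _ subbasicTopology
      (@TopologicalSpace.SecondCountableTopology.to_firstCountableTopology _ subbasicTopology
        secondCountable_subbasicTopology) p
  refine tendsto_id'.1 (tendsto_of_forall_isOpen_le_liminf' (μs := id)
    (L := @nhds _ subbasicTopology p) (μ := p) ?_)
  intro G hG
  refine le_of_forall_lt fun c hc => ?_
  obtain ⟨q, -, hcq, hqG⟩ := ENNReal.lt_iff_exists_rat_btwn.1 hc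
  let b := {s : TopologicalSpace.countableBasis ℝ // (s : Set ℝ) ⊆ G}
  have hcb : Countable b := inferInstance
  have hGb : G = ⋃ F : Finset b, ⋃ s ∈ F, (s.1 : Set ℝ) := by
    rw [← iUnion_eq_iUnion_finset]
    ext x
    simp only [mem_iUnion]
    constructor
    · intro hx
      obtain ⟨s, hs, hxs, hsG⟩ :=
        (TopologicalSpace.isBasis_countableBasis ℝ).exists_subset_of_mem_open hx hG
      exact ⟨⟨⟨s, hs⟩, hsG⟩, hxs⟩
    · rintro ⟨s, hx⟩
      exact s.2 hx
  have hdir : Directed (· ⊆ ·) (fun F : Finset b => ⋃ s ∈ F, (s.1 : Set ℝ)) :=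
    Monotone.directed_le fun F F' h => biUnion_subset_biUnion_left h
  rw [hGb, hdir.measure_iUnion, lt_iSup_iff] at hqG
  obtain ⟨F, hF⟩ := hqG
  classical
  have hFU : (⋃ s ∈ F.image Subtype.val, (s : Set ℝ)) = ⋃ s ∈ F, (s.1 : Set ℝ) :=
    Finset.set_biUnion_finset_image
  have hFG : (⋃ s ∈ F, (s.1 : Set ℝ)) ⊆ G := iUnion₂_subset fun s _ => s.2
  have hopen : @IsOpen _ subbasicTopology (subbasicSet (F.image Subtype.val, q)) :=
    TopologicalSpace.isOpen_generateFrom_of_mem ⟨_, rfl⟩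
  have hmem : p ∈ subbasicSet (F.image Subtype.val, q) := by
    change _ < (p : Measure ℝ) _
    rw [hFU]
    exact hF
  refine lt_of_lt_of_le hcq (le_liminf_of_le (by isBoundedDefault) ?_)
  filter_upwards [@IsOpen.mem_nhds _ subbasicTopology _ _ hopen hmem] with r hr
  change _ < (r : Measure ℝ) _ at hr
  rw [hFU] at hr
  exact hr.le.trans (measure_mono hFG)

theorem measurableSet_of_isOpen {U : Set (ProbabilityMeasure ℝ)} (hU : IsOpen U) :
    MeasurableSet U := by
  have hUT : @IsOpen _ subbasicTopology U :=
    (@isOpen_iff_mem_nhds _ subbasicTopology U).2 fun p hp =>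
      nhds_subbasicTopology_le p (hU.mem_nhds hp)
  have hm : @MeasurableSet _ (@borel _ subbasicTopology) U :=
    MeasurableSpace.measurableSet_generateFrom hUT
  rw [@borel_eq_generateFrom_of_subbasis _ (range subbasicSet) subbasicTopology
    secondCountable_subbasicTopology rfl] at hm
  refine MeasurableSpace.generateFrom_le ?_ U hm
  rintro _ ⟨x, rfl⟩
  refine measurableSet_lt measurable_const (measurable_eval ?_)
  refine Finset.measurableSet_biUnion _ fun s _ => ?_
  exact (TopologicalSpace.isOpen_of_mem_countableBasis s.2).measurableSet

theorem measurable_borel_of_lowerSemicontinuous {δ : Type*} [TopologicalSpace δ]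
    {f : δ → ENNReal} (hf : LowerSemicontinuous f) : @Measurable δ ENNReal (borel δ) _ f := by
  borelize δ
  exact hf.measurable

instance : BorelSpace (ProbabilityMeasure ℝ) where
  measurable_eq := by
    refine le_antisymm ?_ (MeasurableSpace.generateFrom_le fun U hU => measurableSet_of_isOpen hU)
    have hG : ∀ G ∈ {G : Set ℝ | IsOpen G},
        @Measurable _ _ (borel (ProbabilityMeasure ℝ)) _
          (fun p : ProbabilityMeasure ℝ => (p : Measure ℝ) G) := by
      intro G hG
      refine measurable_borel_of_lowerSemicontinuous
        (lowerSemicontinuous_iff_le_liminf.2 fun p => ?_)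
      exact ProbabilityMeasure.le_liminf_measure_open_of_tendsto tendsto_id hG
    have hmeas : @Measurable _ _ (borel (ProbabilityMeasure ℝ)) _
        (fun p : ProbabilityMeasure ℝ => (p : Measure ℝ)) :=
      @Measurable.measure_of_isPiSystem_of_isProbabilityMeasure _ _ (borel _) _ _ inferInstance _
        (BorelSpace.measurable_eq.trans rfl) isPiSystem_isOpen hG
    exact hmeas.comap_le

/-- The reflection `p⁻` of a measure on the line: `p⁻ A = p (-A)`. -/
noncomputable def reflect (p : Measure ℝ) : Measure ℝ := p.map (fun x => -x)

theorem reflect_apply (p : Measure ℝ) {A : Set ℝ} (hA : MeasurableSet A) :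
    reflect p A = p (-A) := by
  rw [reflect, Measure.map_apply measurable_neg hA]
  rfl

instance (p : Measure ℝ) [IsProbabilityMeasure p] : IsProbabilityMeasure (reflect p) :=
  Measure.isProbabilityMeasure_map measurable_neg.aemeasurable

/-- The symmetrization `(p + p⁻) / 2` of a probability measure on the line. -/
noncomputable def symmetrize (p : ProbabilityMeasure ℝ) : ProbabilityMeasure ℝ :=
  ⟨(2 : ENNReal)⁻¹ • ((p : Measure ℝ) + reflect p), ⟨by
    simp [ENNReal.inv_two_add_inv_two]⟩⟩

theorem measurable_symmetrize : Measurable symmetrize := by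
  refine Measurable.subtype_mk (Measure.measurable_of_measurable_coe _ fun A hA => ?_)
  simp only [Measure.smul_apply, Measure.add_apply, reflect_apply _ hA, smul_eq_mul]
  exact ((measurable_eval hA).add (measurable_eval hA.neg)).const_mul _

/-! ### The Dirichlet distribution -/

/-- The gamma distribution with shape `a` and rate `1`, with the usual convention that it is the
point mass at `0` when the shape is `0`. -/
noncomputable def gammaOne (a : ℝ) : Measure ℝ :=
  if 0 < a then gammaMeasure a 1 else Measure.dirac 0

/-- The Dirichlet distribution with parameters `a i ≥ 0`, not all zero: the law of
`(Z i / ∑ j, Z j)` for independent gamma variables `Z i` with shapes `a i`.  Coordinates with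
`a i = 0` are almost surely zero. -/
noncomputable def dirichlet {k : ℕ} (a : Fin k → ℝ) : Measure (Fin k → ℝ) :=
  (Measure.pi fun i => gammaOne (a i)).map fun z i => z i / ∑ j, z j

/-! ### Dirichlet processes -/

/-- `D` is the law `DP(α, P₀)` of a random probability measure `p` on the line: for every finite
measurable partition `A` of the line, `(p (A i))ᵢ` has the Dirichlet distribution with parameters
`(α P₀ (A i))ᵢ`. -/
structure IsDirichletProcess (α : ℝ) (P₀ : Measure ℝ) (D : Measure (ProbabilityMeasure ℝ)) :
    Prop where
  isProbabilityMeasure : IsProbabilityMeasure D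
  hasLaw_partition : ∀ (k : ℕ) (A : Fin k → Set ℝ), (∀ i, MeasurableSet (A i)) →
    Pairwise (fun i j => Disjoint (A i) (A j)) → ⋃ i, A i = univ →
    HasLaw (fun (p : ProbabilityMeasure ℝ) i => (p : Measure ℝ).real (A i))
      (dirichlet fun i => α * P₀.real (A i)) D

/-- `Q` is the law `DP_S(α, P₀)`: the law of `(p + p⁻) / 2` where `p` has law `DP(α, P₀)`. -/
def IsSymDirichletProcess (α : ℝ) (P₀ : Measure ℝ) (Q : Measure (ProbabilityMeasure ℝ)) : Prop :=
  ∃ D, IsDirichletProcess α P₀ D ∧ Q = D.map symmetrize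

/-! ### Sampling from a random probability measure -/

theorem measurable_pi_const (n : ℕ) :
    Measurable (fun p : ProbabilityMeasure ℝ => Measure.pi fun _ : Fin n => (p : Measure ℝ)) := by
  refine Measurable.measure_of_isPiSystem_of_isProbabilityMeasure generateFrom_pi.symm
    isPiSystem_pi ?_
  rintro _ ⟨s, hs, rfl⟩
  simp only [Measure.pi_pi]
  exact Finset.measurable_prod _ fun i _ => measurable_eval (hs i (mem_univ i))

/-- The kernel sending `p` to the law of `n` independent draws from `p`. -/
noncomputable def iidKernel (n : ℕ) : Kernel (ProbabilityMeasure ℝ) (Fin n → ℝ) :=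
  ⟨fun p => Measure.pi fun _ => (p : Measure ℝ), measurable_pi_const n⟩

/-- The updated mean `(α P₀ + ∑ i, δ_{t i}) / (α + n)`. -/
noncomputable def posteriorMean (α : ℝ) (P₀ : Measure ℝ) {n : ℕ} (t : Fin n → ℝ) : Measure ℝ :=
  (ENNReal.ofReal (α + n))⁻¹ • (ENNReal.ofReal α • P₀ + ∑ i, Measure.dirac (t i))

theorem isProbabilityMeasure_posteriorMean {α : ℝ} (hα : 0 < α) (P₀ : Measure ℝ)
    [IsProbabilityMeasure P₀] {n : ℕ} (t : Fin n → ℝ) :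
    IsProbabilityMeasure (posteriorMean α P₀ t) := by
  constructor
  have h : ENNReal.ofReal α + n = ENNReal.ofReal (α + n) := by
    rw [ENNReal.ofReal_add hα.le (Nat.cast_nonneg n), ENNReal.ofReal_natCast]
  have h0 : ENNReal.ofReal (α + n) ≠ 0 := by
    rw [Ne, ENNReal.ofReal_eq_zero, not_le]
    positivity
  simp [posteriorMean, h, ENNReal.inv_mul_cancel h0, -smul_add, smul_eq_mul]

/-- The predictive distribution
`α / (2 (α + n)) (P₀ + P₀⁻) + 1 / (2 (α + n)) ∑ i, (δ_{t i} + δ_{-t i})`. -/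
noncomputable def predictive (α : ℝ) (P₀ : Measure ℝ) {n : ℕ} (t : Fin n → ℝ) : Measure ℝ :=
  ENNReal.ofReal (α / (2 * (α + n))) • (P₀ + reflect P₀) +
    ENNReal.ofReal (1 / (2 * (α + n))) • ∑ i, (Measure.dirac (t i) + Measure.dirac (-t i))

end SymDP

namespace SymDP

/-! The core is a one-draw Bayes identity for `D` of law DP(α, P₀): drawing p from `D` and then x
from p gives the same joint law as drawing x from P₀ and then setting p = b p' + (1 - b) δ_x, with
p' of law `D` and b an independent Beta(α, 1) weight (`IsDirichletProcess.lintegral_lintegral`). The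
updated law is again a Dirichlet process, with δ_x added to α P₀ (`IsDirichletProcess.updateLaw`).
Posteriors are thus built from the given prior, and no separate existence theorem is needed.

On a finite partition both claims are facts about independent gamma variables. Their ratios to the
sum are independent of the sum (`map_normalize_sum`). Weighting a gamma law by its own variable
raises the shape by one (`gammaOne_withDensity_id`), and so does adding an independent exponential
(`map_add_single_pi_gammaOne`). Finite-dimensional laws then determine everything
(`ext_of_finite_masses`).

A draw from (p + p⁻)/2 is a draw from p with a fair random sign. Symmetrization is affine, so it
commutes with the update, and δ_x and δ_{-x} have the same symmetrization, so the unknown sign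
leaves no trace in the posterior. Hence the one-draw identity survives symmetrization, the draw now
having law (P₀ + P₀⁻)/2. Iterating it gives conjugacy (`exists_isPosterior`). The next draw follows
the symmetrized posterior mean (`predictive_eq`), which is the urn rule. -/

/-! ### Uniqueness of Laplace transforms. -/

theorem iio_one_subset_integrableExpSet {μ : Measure ℝ}
    (hμ : ∀ t < 1, ∫⁻ x, ENNReal.ofReal (Real.exp (t * x)) ∂μ ≠ ⊤) :
    Iio 1 ⊆ interior (integrableExpSet id μ) := by
  refine interior_maximal (fun t ht => ?_) isOpen_Iio
  refine ⟨by fun_prop, ?_⟩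
  rw [hasFiniteIntegral_iff_ofReal (ae_of_all _ fun x => (Real.exp_pos _).le)]
  exact (hμ t ht).lt_top

/-- A finite measure on the line is determined by its moment generating function on
`(-∞, 1)`, when it is finite there. -/
theorem ext_of_lintegral_exp {μ ν : Measure ℝ} [IsFiniteMeasure μ] [IsFiniteMeasure ν]
    (hμ : ∀ t < 1, ∫⁻ x, ENNReal.ofReal (Real.exp (t * x)) ∂μ ≠ ⊤)
    (h : ∀ t < 1, ∫⁻ x, ENNReal.ofReal (Real.exp (t * x)) ∂μ =
      ∫⁻ x, ENNReal.ofReal (Real.exp (t * x)) ∂ν) : μ = ν := by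
  have hsμ := iio_one_subset_integrableExpSet hμ
  have hsν := iio_one_subset_integrableExpSet (μ := ν) fun t ht => by rw [← h t ht]; exact hμ t ht
  have hmgf : ∀ t < 1, mgf id μ t = mgf id ν t := by
    intro t ht
    simp only [mgf, id]
    rw [integral_eq_lintegral_of_nonneg_ae (ae_of_all _ fun x => (Real.exp_pos _).le)
      (by fun_prop), integral_eq_lintegral_of_nonneg_ae
      (ae_of_all _ fun x => (Real.exp_pos _).le) (by fun_prop), h t ht]
  have hX : AnalyticOnNhd ℂ (complexMGF id μ) {z | z.re < 1} :=
    analyticOnNhd_complexMGF.mono fun z hz => hsμ hz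
  have hY : AnalyticOnNhd ℂ (complexMGF id ν) {z | z.re < 1} :=
    analyticOnNhd_complexMGF.mono fun z hz => hsν hz
  have hEq : EqOn (complexMGF id μ) (complexMGF id ν) {z | z.re < 1} := by
    refine AnalyticOnNhd.eqOn_of_preconnected_of_frequently_eq hX hY
      (convex_halfSpace_re_lt 1).isPreconnected (z₀ := 0) (by simp) ?_
    -- The identity theorem needs agreement only along points accumulating at 0; these are real,
    -- nonzero and to the left of 1.
    have hseq : Tendsto (fun n : ℕ => ((-(1 / ((n : ℝ) + 1)) : ℝ) : ℂ)) atTop (𝓝[≠] 0) := by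
      refine tendsto_nhdsWithin_iff.2 ⟨?_, Eventually.of_forall fun n => ?_⟩
      · have := (tendsto_one_div_add_atTop_nhds_zero_nat (𝕜 := ℝ)).neg
        rw [neg_zero] at this
        exact_mod_cast (Complex.continuous_ofReal.tendsto 0).comp this
      · simp only [mem_compl_iff, mem_singleton_iff, Complex.ofReal_eq_zero]
        have : 0 < 1 / ((n : ℝ) + 1) := by positivity
        linarith
    refine hseq.frequently (Frequently.of_forall fun n => ?_)
    rw [complexMGF_ofReal, complexMGF_ofReal, hmgf]
    have : 0 < 1 / ((n : ℝ) + 1) := by positivity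
    linarith
  refine Measure.ext_of_charFun (funext fun t => ?_)
  -- The imaginary axis lies in the half-plane re z < 1, and there the complex transform is the
  -- characteristic function.
  rw [← complexMGF_id_mul_I, ← complexMGF_id_mul_I]
  exact hEq (by simp)

/-! ### Gamma distributions -/

theorem gammaOne_of_pos {a : ℝ} (ha : 0 < a) : gammaOne a = gammaMeasure a 1 := if_pos ha

theorem gammaOne_zero : gammaOne 0 = Measure.dirac 0 := if_neg (lt_irrefl 0)

instance (a : ℝ) : IsProbabilityMeasure (gammaOne a) := by
  unfold gammaOne
  split_ifs with h
  · exact isProbabilityMeasure_gammaMeasure h one_pos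
  · infer_instance

theorem ae_nonneg_gammaOne (a : ℝ) : ∀ᵐ x ∂gammaOne a, 0 ≤ x := by
  unfold gammaOne
  split_ifs with h
  · rw [gammaMeasure, ae_withDensity_iff (by unfold gammaPDF; fun_prop)]
    refine ae_of_all _ fun x hx => ?_
    by_contra hneg
    exact hx (gammaPDF_of_neg (not_le.1 hneg))
  · simp [ae_dirac_eq]

theorem ae_pos_gammaOne {a : ℝ} (ha : 0 < a) : ∀ᵐ x ∂gammaOne a, 0 < x := by
  have hne : ∀ᵐ x ∂gammaOne a, x ≠ 0 := by
    rw [gammaOne_of_pos ha, gammaMeasure]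
    refine (withDensity_absolutelyContinuous _ _).ae_le ?_
    exact compl_mem_ae_iff.2 Real.volume_singleton
  filter_upwards [ae_nonneg_gammaOne a, hne] with x h0 h1 using lt_of_le_of_ne h0 h1.symm

theorem dirac_withDensity (x : ℝ) {f : ℝ → ENNReal} (hf : Measurable f) :
    (Measure.dirac x).withDensity f = f x • Measure.dirac x := by
  classical
  ext s hs
  rw [withDensity_apply _ hs, setLIntegral_dirac' hf hs, Measure.smul_apply,
    Measure.dirac_apply' _ hs, smul_eq_mul]
  by_cases hx : x ∈ s <;> simp [hx]

/-- Exponential tilting of a gamma distribution is a change of scale. -/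
theorem gammaOne_withDensity_exp {a t : ℝ} (ha : 0 ≤ a) (ht : t < 1) :
    (gammaOne a).withDensity (fun x => ENNReal.ofReal (Real.exp (t * x))) =
      ENNReal.ofReal ((1 - t) ^ (-a)) • (gammaOne a).map (fun x => x / (1 - t)) := by
  have hc : 0 < 1 - t := by linarith
  have hdiv : Measurable fun x : ℝ => x / (1 - t) := by fun_prop
  rcases ha.eq_or_lt with rfl | ha
  · rw [gammaOne_zero, Measure.map_dirac' hdiv, dirac_withDensity _ (by fun_prop)]
    simp
  · rw [gammaOne_of_pos ha, gammaMeasure]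
    have hm : Measurable (gammaPDF a 1) := by unfold gammaPDF; fun_prop
    ext s hs
    have hcomp : Measurable fun x =>
        ((fun x => x / (1 - t)) ⁻¹' s).indicator (gammaPDF a 1) ((1 - t) * x) :=
      (hm.indicator (hdiv hs)).comp (measurable_const_mul (1 - t))
    rw [← withDensity_mul _ hm (by fun_prop), withDensity_apply _ hs, Measure.smul_apply,
      Measure.map_apply hdiv hs, withDensity_apply _ (hdiv hs), smul_eq_mul]
    -- Substitution x ↦ (1 - t) x in Lebesgue measure, performed on the right side only.
    conv_rhs => rw [← Real.smul_map_volume_mul_left hc.ne', Measure.restrict_smul]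
    rw [lintegral_smul_measure, ← lintegral_indicator (hdiv hs),
      lintegral_map (hm.indicator (hdiv hs)) (by fun_prop), smul_eq_mul,
      ← lintegral_indicator hs, abs_of_pos hc, ← mul_assoc,
      ← lintegral_const_mul _ hcomp]
    refine lintegral_congr fun x => ?_
    by_cases hx : x ∈ s
    · have hx' : (1 - t) * x ∈ (fun x => x / (1 - t)) ⁻¹' s := by
        simpa [mul_div_cancel_left₀ _ hc.ne'] using hx
      rw [indicator_of_mem hx, indicator_of_mem hx', Pi.mul_apply]
      rcases lt_or_ge x 0 with h0 | h0
      · rw [gammaPDF_of_neg h0, gammaPDF_of_neg (mul_neg_of_pos_of_neg hc h0)]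
        simp
      · rw [gammaPDF_of_nonneg h0, gammaPDF_of_nonneg (by positivity),
          ← ENNReal.ofReal_mul (by positivity), ← ENNReal.ofReal_mul (by positivity),
          ← ENNReal.ofReal_mul (by positivity)]
        congr 1
        rw [Real.mul_rpow hc.le h0, Real.rpow_sub_one hc.ne', Real.rpow_neg hc.le,
          show -(1 * ((1 - t) * x)) = -(1 * x) + t * x by ring, Real.exp_add]
        have := (Real.rpow_pos_of_pos hc a).ne'
        field_simp
    · have hx' : (1 - t) * x ∉ (fun x => x / (1 - t)) ⁻¹' s := by
        simpa [mul_div_cancel_left₀ _ hc.ne'] using hx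
      rw [indicator_of_notMem hx, indicator_of_notMem hx', mul_zero]

theorem lintegral_exp_gammaOne {a t : ℝ} (ha : 0 ≤ a) (ht : t < 1) :
    ∫⁻ x, ENNReal.ofReal (Real.exp (t * x)) ∂gammaOne a = ENNReal.ofReal ((1 - t) ^ (-a)) := by
  have h := congrArg (fun μ => μ univ) (gammaOne_withDensity_exp ha ht)
  simp only [Measure.smul_apply, smul_eq_mul] at h
  rwa [withDensity_apply _ MeasurableSet.univ, Measure.restrict_univ,
    Measure.map_apply (by fun_prop) MeasurableSet.univ, preimage_univ, measure_univ, mul_one] at h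

/-- The size-biased gamma distribution. -/
theorem gammaOne_withDensity_id {a : ℝ} (ha : 0 ≤ a) :
    (gammaOne a).withDensity ENNReal.ofReal = ENNReal.ofReal a • gammaOne (a + 1) := by
  rcases ha.eq_or_lt with rfl | ha
  · rw [gammaOne_zero, dirac_withDensity _ ENNReal.measurable_ofReal]
    simp
  · have hm : ∀ b, Measurable (gammaPDF b 1) := fun b => by unfold gammaPDF; fun_prop
    rw [gammaOne_of_pos ha, gammaOne_of_pos (by linarith), gammaMeasure, gammaMeasure,
      ← withDensity_mul _ (hm a) (by fun_prop), ← withDensity_smul _ (hm _)]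
    refine withDensity_congr_ae ?_
    have hne : ∀ᵐ x : ℝ, x ≠ 0 := compl_mem_ae_iff.2 Real.volume_singleton
    filter_upwards [hne] with x hx
    rcases lt_or_ge x 0 with h0 | h0
    · simp [gammaPDF_of_neg h0]
    · rw [Pi.mul_apply, Pi.smul_apply, smul_eq_mul, gammaPDF_of_nonneg h0, gammaPDF_of_nonneg h0,
        ← ENNReal.ofReal_mul (by positivity), ← ENNReal.ofReal_mul (by positivity)]
      congr 1
      rw [Real.Gamma_add_one ha.ne', Real.rpow_sub_one hx, Real.rpow_sub_one hx,
        Real.rpow_add_one hx, Real.one_rpow, Real.one_rpow]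
      have := (Real.Gamma_pos_of_pos ha).ne'
      field_simp

/-- Gamma distributions form a convolution semigroup. -/
theorem map_add_gammaOne {a b : ℝ} (ha : 0 ≤ a) (hb : 0 ≤ b) :
    ((gammaOne a).prod (gammaOne b)).map (fun z => z.1 + z.2) = gammaOne (a + b) := by
  have : IsProbabilityMeasure (((gammaOne a).prod (gammaOne b)).map (fun z => z.1 + z.2)) :=
    Measure.isProbabilityMeasure_map (by fun_prop)
  symm
  refine ext_of_lintegral_exp (fun t ht => ?_) fun t ht => ?_
  · rw [lintegral_exp_gammaOne (by positivity) ht]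
    exact ENNReal.ofReal_ne_top
  · rw [lintegral_exp_gammaOne (by positivity) ht, lintegral_map (by fun_prop) (by fun_prop)]
    simp_rw [mul_add, Real.exp_add, ENNReal.ofReal_mul (Real.exp_pos _).le]
    rw [lintegral_prod_mul (f := fun x => ENNReal.ofReal (Real.exp (t * x)))
      (g := fun x => ENNReal.ofReal (Real.exp (t * x))) (by fun_prop) (by fun_prop),
      lintegral_exp_gammaOne ha ht, lintegral_exp_gammaOne hb ht,
      ← ENNReal.ofReal_mul (Real.rpow_nonneg (by linarith) _), ← Real.rpow_add (by linarith),
      neg_add]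

/-! ### Products of measures with densities -/

theorem pi_withDensity {ι : Type*} [Fintype ι] (μ : ι → Measure ℝ)
    [∀ i, IsProbabilityMeasure (μ i)] (f : ι → ℝ → ENNReal) (hf : ∀ i, Measurable (f i))
    [∀ i, SigmaFinite ((μ i).withDensity (f i))] :
    (Measure.pi μ).withDensity (fun z => ∏ i, f i (z i)) =
      Measure.pi fun i => (μ i).withDensity (f i) := by
  refine (Measure.pi_eq fun s hs => ?_).symm
  rw [withDensity_apply _ (MeasurableSet.univ_pi hs), ← lintegral_indicator (MeasurableSet.univ_pi hs)]
  have h1 : ∀ z : ι → ℝ, (univ.pi s).indicator (fun z => ∏ i, f i (z i)) z =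
      ∏ i, (s i).indicator (f i) (z i) := by
    intro z
    by_cases hz : z ∈ univ.pi s
    · rw [indicator_of_mem hz]
      exact Finset.prod_congr rfl fun i _ => (indicator_of_mem (hz i (mem_univ i)) _).symm
    · rw [indicator_of_notMem hz]
      simp only [mem_univ_pi, not_forall] at hz
      obtain ⟨i, hi⟩ := hz
      exact (Finset.prod_eq_zero (Finset.mem_univ i) (indicator_of_notMem hi _)).symm
  have hm : ∀ i, Measurable ((s i).indicator (f i)) := fun i => (hf i).indicator (hs i)
  simp_rw [h1]
  rw [lintegral_prod_eq_prod_lintegral_of_indepFun Finset.univ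
    (fun i (z : ι → ℝ) => (s i).indicator (f i) (z i))
    (iIndepFun_pi fun i => (hm i).aemeasurable) fun i => (hm i).comp (measurable_pi_apply i)]
  refine Finset.prod_congr rfl fun i _ => ?_
  rw [withDensity_apply _ (hs i), ← lintegral_indicator (hs i),
    ← (measurePreserving_eval μ i).lintegral_comp (hm i)]

theorem pi_smul {ι : Type*} [Fintype ι] (c : ι → ENNReal) (hc : ∀ i, c i ≠ ⊤)
    (μ : ι → Measure ℝ) [∀ i, IsProbabilityMeasure (μ i)] :
    Measure.pi (fun i => c i • μ i) = (∏ i, c i) • Measure.pi μ := by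
  have : ∀ i, IsFiniteMeasure (c i • μ i) := fun i => (μ i).smul_finite (hc i)
  refine Measure.pi_eq fun s hs => ?_
  simp [Measure.pi_pi, Finset.prod_mul_distrib]

/-! ### Independence of ratios and sum -/

theorem measurable_normalize {k : ℕ} :
    Measurable fun (z : Fin k → ℝ) i => z i / ∑ j, z j := by
  fun_prop

instance {k : ℕ} (a : Fin k → ℝ) : IsProbabilityMeasure (dirichlet a) :=
  Measure.isProbabilityMeasure_map measurable_normalize.aemeasurable

/-- The tilt by the sum factorises over coordinates, and each coordinate is rescaled by the same 1 -
t. This common factor is what leaves the ratios to the sum unaffected. -/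
theorem pi_gammaOne_withDensity_exp {k : ℕ} {a : Fin k → ℝ} (ha : ∀ i, 0 ≤ a i) {t : ℝ}
    (ht : t < 1) :
    (Measure.pi fun i => gammaOne (a i)).withDensity
        (fun z => ENNReal.ofReal (Real.exp (t * ∑ i, z i))) =
      ENNReal.ofReal ((1 - t) ^ (-∑ i, a i)) •
        (Measure.pi fun i => gammaOne (a i)).map (fun z i => z i / (1 - t)) := by
  have hc : 0 < 1 - t := by linarith
  have hP : ∀ i, IsProbabilityMeasure ((gammaOne (a i)).map (fun x => x / (1 - t))) := fun i =>
    Measure.isProbabilityMeasure_map (by fun_prop)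
  have hS : ∀ i, SigmaFinite ((gammaOne (a i)).withDensity
      (fun x => ENNReal.ofReal (Real.exp (t * x)))) := fun i => inferInstance
  have h1 : ∀ z : Fin k → ℝ, ENNReal.ofReal (Real.exp (t * ∑ i, z i)) =
      ∏ i, ENNReal.ofReal (Real.exp (t * z i)) := by
    intro z
    rw [Finset.mul_sum, Real.exp_sum, ENNReal.ofReal_prod_of_nonneg fun i _ => (Real.exp_pos _).le]
  simp_rw [h1]
  rw [pi_withDensity (fun i => gammaOne (a i))
    (fun _ x => ENNReal.ofReal (Real.exp (t * x))) fun i => by fun_prop]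
  simp_rw [gammaOne_withDensity_exp (ha _) ht]
  rw [pi_smul _ (fun i => ENNReal.ofReal_ne_top),
    Measure.pi_map_pi (f := fun _ x => x / (1 - t)) fun i => by fun_prop,
    ← ENNReal.ofReal_prod_of_nonneg fun i _ => Real.rpow_nonneg hc.le _,
    ← Finset.sum_neg_distrib, Real.rpow_sum_of_pos hc]

/-- For independent gamma variables the vector of ratios to the sum is independent of the sum,
which has a gamma distribution. -/
theorem map_normalize_sum {k : ℕ} {a : Fin k → ℝ} (ha : ∀ i, 0 ≤ a i) :
    (Measure.pi fun i => gammaOne (a i)).map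
        (fun z => ((fun i => z i / ∑ j, z j : Fin k → ℝ), ∑ j, z j)) =
      (dirichlet a).prod (gammaOne (∑ i, a i)) := by
  set G := Measure.pi fun i => gammaOne (a i)
  have hsum : Measurable fun z : Fin k → ℝ => ∑ j, z j := by fun_prop
  symm
  refine Measure.prod_eq fun E T hE hT => ?_
  have hR : MeasurableSet ((fun (z : Fin k → ℝ) i => z i / ∑ j, z j) ⁻¹' E) :=
    measurable_normalize hE
  -- For fixed `E`, compare Laplace transforms of the sum. Tilting by exp(t ∑ z) contributes a
  -- constant and a common rescaling, under which the event that the ratios lie in `E` is invariant.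
  have key : dirichlet a E • gammaOne (∑ i, a i) =
      (G.restrict ((fun (z : Fin k → ℝ) i => z i / ∑ j, z j) ⁻¹' E)).map
        (fun z => ∑ j, z j) := by
    have : IsFiniteMeasure (dirichlet a E • gammaOne (∑ i, a i)) :=
      (gammaOne _).smul_finite (measure_ne_top _ _)
    have hL : ∀ t < 1, ∫⁻ x, ENNReal.ofReal (Real.exp (t * x))
        ∂(dirichlet a E • gammaOne (∑ i, a i)) =
        dirichlet a E * ENNReal.ofReal ((1 - t) ^ (-∑ i, a i)) := by
      intro t ht
      rw [lintegral_smul_measure, lintegral_exp_gammaOne (Finset.sum_nonneg fun i _ => ha i) ht,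
        smul_eq_mul]
    refine ext_of_lintegral_exp (fun t ht => ?_) fun t ht => ?_
    · rw [hL t ht]
      exact ENNReal.mul_ne_top (measure_ne_top _ _) ENNReal.ofReal_ne_top
    · have hc : (1 - t) ≠ 0 := by linarith
      rw [hL t ht, lintegral_map (by fun_prop) hsum, ← withDensity_apply _ hR,
        pi_gammaOne_withDensity_exp ha ht, Measure.smul_apply,
        Measure.map_apply (by fun_prop) hR, smul_eq_mul, mul_comm]
      congr 1
      rw [dirichlet, Measure.map_apply measurable_normalize hE]
      congr 1
      ext z
      simp only [mem_preimage, ← Finset.sum_div, div_div_div_cancel_right₀ hc]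
  have := congrArg (fun μ => μ T) key
  simp only [Measure.smul_apply, smul_eq_mul] at this
  rw [this, Measure.map_apply hsum hT, Measure.restrict_apply (hsum hT),
    Measure.map_apply (by fun_prop) (hE.prod hT)]
  congr 1
  ext z
  simp [and_comm]

/-- The size-biased Dirichlet distribution. -/
theorem setLIntegral_dirichlet {k : ℕ} {a : Fin k → ℝ} (ha : ∀ i, 0 ≤ a i) (j : Fin k)
    {E : Set (Fin k → ℝ)} (hE : MeasurableSet E) :
    ENNReal.ofReal (∑ i, a i) * ∫⁻ y in E, ENNReal.ofReal (y j) ∂dirichlet a =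
      ENNReal.ofReal (a j) * dirichlet (fun i => a i + (Pi.single j 1 : Fin k → ℝ) i) E := by
  set G := Measure.pi fun i => gammaOne (a i) with hG
  have hR : MeasurableSet ((fun (z : Fin k → ℝ) i => z i / ∑ j, z j) ⁻¹' E) :=
    measurable_normalize hE
  have hmean : ∫⁻ s, ENNReal.ofReal s ∂gammaOne (∑ i, a i) = ENNReal.ofReal (∑ i, a i) := by
    have h := congrArg (fun μ => μ univ)
      (gammaOne_withDensity_id (Finset.sum_nonneg fun i (_ : i ∈ Finset.univ) => ha i))
    simpa using h
  have hnn : ∀ᵐ z ∂G, ∀ i, 0 ≤ z i := by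
    rw [ae_all_iff]
    intro i
    exact (measurePreserving_eval (fun i => gammaOne (a i)) i).quasiMeasurePreserving.ae
      (ae_nonneg_gammaOne (a i))
  -- The total parameter is the mean of the sum S. By independence of S and the ratios, the product
  -- of the two integrals becomes the integral of S · (z j / S) = z j.
  have h1 : ENNReal.ofReal (∑ i, a i) * ∫⁻ y in E, ENNReal.ofReal (y j) ∂dirichlet a =
      ∫⁻ z in (fun (z : Fin k → ℝ) i => z i / ∑ j, z j) ⁻¹' E, ENNReal.ofReal (z j) ∂G := by
    have hind : Measurable (E.indicator fun y => ENNReal.ofReal (y j)) :=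
      Measurable.indicator (by fun_prop) hE
    rw [← hmean, mul_comm, ← lintegral_indicator hE,
      ← lintegral_prod_mul (g := ENNReal.ofReal) hind.aemeasurable (by fun_prop),
      ← map_normalize_sum ha, lintegral_map, ← lintegral_indicator hR]
    · refine lintegral_congr_ae ?_
      filter_upwards [hnn] with z hz
      by_cases hzE : (fun i => z i / ∑ j, z j) ∈ E
      · rw [indicator_of_mem hzE, indicator_of_mem (a := z) hzE]
        have hs := Finset.sum_nonneg fun i (_ : i ∈ Finset.univ) => hz i
        rw [← ENNReal.ofReal_mul (div_nonneg (hz j) hs)]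
        -- When the sum vanishes, so does `z j`, and the convention 0 / 0 = 0 does no harm.
        rcases hs.eq_or_lt with h0 | h0
        · have := (Finset.sum_eq_zero_iff_of_nonneg fun i _ => hz i).1 h0.symm j (Finset.mem_univ j)
          simp [this]
        · rw [div_mul_cancel₀ _ h0.ne']
      · rw [indicator_of_notMem hzE, indicator_of_notMem (a := z) hzE, zero_mul]
    · exact (hind.comp measurable_fst).mul (by fun_prop)
    · fun_prop
  have h2 : G.withDensity (fun z => ENNReal.ofReal (z j)) = ENNReal.ofReal (a j) •
      Measure.pi fun i => gammaOne (a i + (Pi.single j 1 : Fin k → ℝ) i) := by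
    -- The weight `z j` is written as a product density whose factors other than the `j`-th are 1.
    let f : Fin k → ℝ → ENNReal := fun i => if i = j then ENNReal.ofReal else fun _ => 1
    let c : Fin k → ENNReal := fun i => if i = j then ENNReal.ofReal (a j) else 1
    have hf : ∀ z : Fin k → ℝ, ENNReal.ofReal (z j) = ∏ i, f i (z i) := by
      intro z
      rw [Finset.prod_eq_single j (fun i _ hij => by simp [f, hij]) (by simp)]
      simp [f]
    have hfm : ∀ i, Measurable (f i) := by
      intro i
      by_cases hij : i = j
      · simp only [f, hij, if_true]; fun_prop
      · simp only [f, hij, if_false]; fun_prop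
    have hw : ∀ i, (gammaOne (a i)).withDensity (f i) =
        c i • gammaOne (a i + (Pi.single j 1 : Fin k → ℝ) i) := by
      intro i
      by_cases hij : i = j
      · subst hij
        simp [f, c, gammaOne_withDensity_id (ha i)]
      · have : f i = 1 := by simp only [f, hij, if_false]; rfl
        rw [this, withDensity_one]
        simp [c, hij]
    have hct : ∀ i, c i ≠ ⊤ := fun i => by
      by_cases hij : i = j <;> simp [c, hij]
    have : ∀ i, SigmaFinite ((gammaOne (a i)).withDensity (f i)) := fun i => by
      rw [hw]
      have := (gammaOne (a i + (Pi.single j 1 : Fin k → ℝ) i)).smul_finite (hct i)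
      infer_instance
    rw [show (fun z : Fin k → ℝ => ENNReal.ofReal (z j)) = fun z => ∏ i, f i (z i) from funext hf,
      hG, pi_withDensity _ f hfm]
    simp_rw [hw]
    rw [pi_smul _ hct]
    congr 1
    rw [Finset.prod_eq_single j (fun i _ hij => by simp [c, hij]) (by simp)]
    simp [c]
  rw [h1, ← withDensity_apply _ hR, h2, Measure.smul_apply, smul_eq_mul, dirichlet,
    Measure.map_apply measurable_normalize hE]

/-- Adding an independent standard exponential variable to one of finitely many independent gamma
variables raises its shape by one. -/
theorem map_add_single_pi_gammaOne {k : ℕ} {a : Fin k → ℝ} (ha : ∀ i, 0 ≤ a i) (j : Fin k) :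
    ((Measure.pi fun i => gammaOne (a i)).prod (gammaOne 1)).map
        (fun w i => w.1 i + (Pi.single j w.2 : Fin k → ℝ) i) =
      Measure.pi fun i => gammaOne (a i + (Pi.single j 1 : Fin k → ℝ) i) := by
  have hm : Measurable fun (w : (Fin k → ℝ) × ℝ) i => w.1 i + (Pi.single j w.2 : Fin k → ℝ) i := by
    refine measurable_pi_lambda _ fun i => ?_
    by_cases hij : i = j
    · subst hij; simp only [Pi.single_eq_same]; fun_prop
    · simp only [Pi.single_eq_of_ne hij]; fun_prop
  symm
  refine Measure.pi_eq fun s hs => ?_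
  have hpre : ∀ g : ℝ, (fun z => (z, g)) ⁻¹'
      ((fun (w : (Fin k → ℝ) × ℝ) i => w.1 i + (Pi.single j w.2 : Fin k → ℝ) i) ⁻¹' univ.pi s) =
      univ.pi fun i => (fun x => x + (Pi.single j g : Fin k → ℝ) i) ⁻¹' s i := by
    intro g
    ext z
    simp
  rw [Measure.map_apply hm (MeasurableSet.univ_pi hs),
    Measure.prod_apply_symm (hm (MeasurableSet.univ_pi hs))]
  simp_rw [hpre, Measure.pi_pi]
  -- Only the `j`-th side of the box depends on `g`; integrating that factor over `g` gives a
  -- convolution of gamma laws.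
  have hsplit : ∀ g : ℝ, ∏ i, gammaOne (a i)
        ((fun x => x + (Pi.single j g : Fin k → ℝ) i) ⁻¹' s i) =
      gammaOne (a j) ((fun x => x + g) ⁻¹' s j) *
        ∏ i ∈ Finset.univ.erase j, gammaOne (a i) (s i) := by
    intro g
    rw [← Finset.mul_prod_erase _ _ (Finset.mem_univ j), Pi.single_eq_same]
    congr 1
    refine Finset.prod_congr rfl fun i hi => ?_
    simp [Pi.single_eq_of_ne (Finset.ne_of_mem_erase hi)]
  simp_rw [hsplit]
  have hadd : Measurable fun z : ℝ × ℝ => z.1 + z.2 := by fun_prop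
  have hmeas : Measurable fun g : ℝ => gammaOne (a j) ((fun x => x + g) ⁻¹' s j) :=
    measurable_measure_prodMk_right (hadd (hs j))
  rw [lintegral_mul_const _ hmeas,
    ← Finset.mul_prod_erase _ _ (Finset.mem_univ j), Pi.single_eq_same,
    ← map_add_gammaOne (ha j) zero_le_one, Measure.map_apply hadd (hs j),
    Measure.prod_apply_symm (hadd (hs j))]
  congr 1
  refine Finset.prod_congr rfl fun i hi => ?_
  simp [Pi.single_eq_of_ne (Finset.ne_of_mem_erase hi)]

/-! ### Mixtures -/

/-- The mixture `b p + (1 - b) r`, where `b` is clipped to `[0, 1]`. -/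
noncomputable def mix (b : ℝ) (p r : ProbabilityMeasure ℝ) : ProbabilityMeasure ℝ :=
  ⟨ENNReal.ofReal (max 0 (min b 1)) • (p : Measure ℝ) +
    ENNReal.ofReal (1 - max 0 (min b 1)) • (r : Measure ℝ), ⟨by
    have h : 0 ≤ 1 - max 0 (min b 1) := by
      rw [sub_nonneg]
      exact max_le zero_le_one (min_le_right _ _)
    rw [Measure.add_apply, Measure.smul_apply, Measure.smul_apply, measure_univ, measure_univ,
      smul_eq_mul, smul_eq_mul, mul_one, mul_one, ← ENNReal.ofReal_add (le_max_left _ _) h,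
      add_sub_cancel, ENNReal.ofReal_one]⟩⟩

theorem mix_apply (b : ℝ) (p r : ProbabilityMeasure ℝ) (A : Set ℝ) :
    (mix b p r : Measure ℝ) A = ENNReal.ofReal (max 0 (min b 1)) * (p : Measure ℝ) A +
      ENNReal.ofReal (1 - max 0 (min b 1)) * (r : Measure ℝ) A := by
  simp [mix]

theorem mix_real {b : ℝ} (h0 : 0 ≤ b) (h1 : b ≤ 1) (p r : ProbabilityMeasure ℝ) (A : Set ℝ) :
    (mix b p r : Measure ℝ).real A =
      b * (p : Measure ℝ).real A + (1 - b) * (r : Measure ℝ).real A := by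
  rw [measureReal_def, mix_apply, min_eq_left h1, max_eq_right h0, ENNReal.toReal_add
    (ENNReal.mul_ne_top ENNReal.ofReal_ne_top (measure_ne_top _ _))
    (ENNReal.mul_ne_top ENNReal.ofReal_ne_top (measure_ne_top _ _)), ENNReal.toReal_mul,
    ENNReal.toReal_mul, ENNReal.toReal_ofReal h0, ENNReal.toReal_ofReal (by linarith),
    measureReal_def, measureReal_def]

theorem measurable_mix {X : Type*} [MeasurableSpace X] {b : X → ℝ}
    {p r : X → ProbabilityMeasure ℝ} (hb : Measurable b) (hp : Measurable p) (hr : Measurable r) :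
    Measurable fun x => mix (b x) (p x) (r x) := by
  refine Measurable.subtype_mk (Measure.measurable_of_measurable_coe _ fun A hA => ?_)
  have h1 := (measurable_eval hA).comp hp
  have h2 := (measurable_eval hA).comp hr
  simp only [Measure.add_apply, Measure.smul_apply, smul_eq_mul]
  exact ((by fun_prop : Measurable fun x => ENNReal.ofReal (max 0 (min (b x) 1))).mul h1).add
    ((by fun_prop : Measurable fun x => ENNReal.ofReal (1 - max 0 (min (b x) 1))).mul h2)

/-- The law of `g₀ / (g₀ + g₁)` for independent gamma variables of shapes `a` and `1`. -/
noncomputable def betaLaw (a : ℝ) : Measure ℝ :=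
  ((gammaOne a).prod (gammaOne 1)).map fun w => w.1 / (w.1 + w.2)

instance (a : ℝ) : IsProbabilityMeasure (betaLaw a) :=
  Measure.isProbabilityMeasure_map (by fun_prop)

/-- The law of the mixture of a random probability measure of law `D` with the fixed measure `r`,
the weight of the former having the law `betaLaw a`. -/
noncomputable def updateLaw (a : ℝ) (D : Measure (ProbabilityMeasure ℝ)) (r : ProbabilityMeasure ℝ) :
    Measure (ProbabilityMeasure ℝ) :=
  (D.prod (betaLaw a)).map fun w => mix w.2 w.1 r

theorem measurable_mix_const (r : ProbabilityMeasure ℝ) :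
    Measurable fun w : ProbabilityMeasure ℝ × ℝ => mix w.2 w.1 r :=
  measurable_mix measurable_snd measurable_fst measurable_const

instance (a : ℝ) (D : Measure (ProbabilityMeasure ℝ)) [IsProbabilityMeasure D]
    (r : ProbabilityMeasure ℝ) : IsProbabilityMeasure (updateLaw a D r) :=
  Measure.isProbabilityMeasure_map (measurable_mix_const r).aemeasurable

/-- The beta weight is opened into its two gammas, so that the first can later play the total of the
gammas behind a Dirichlet vector. -/
theorem lintegral_updateLaw (a : ℝ) (D : Measure (ProbabilityMeasure ℝ)) [IsProbabilityMeasure D]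
    (r : ProbabilityMeasure ℝ) {F : ProbabilityMeasure ℝ → ENNReal} (hF : Measurable F) :
    ∫⁻ p, F p ∂updateLaw a D r =
      ∫⁻ p, ∫⁻ w, F (mix (w.1 / (w.1 + w.2)) p r) ∂(gammaOne a).prod (gammaOne 1) ∂D := by
  have hm : Measurable fun w : ProbabilityMeasure ℝ × ℝ => F (mix w.2 w.1 r) :=
    hF.comp (measurable_mix_const r)
  rw [updateLaw, lintegral_map hF (measurable_mix_const r), lintegral_prod _ hm.aemeasurable]
  refine lintegral_congr fun p => ?_
  exact lintegral_map (hm.comp measurable_prodMk_left) (by fun_prop)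

/-- `updateLaw` applied to the values of a kernel. -/
noncomputable def updateKernel {X : Type*} [MeasurableSpace X] (a : ℝ)
    (κ : Kernel X (ProbabilityMeasure ℝ)) [IsMarkovKernel κ] (r : X → ProbabilityMeasure ℝ)
    (hr : Measurable r) : Kernel X (ProbabilityMeasure ℝ) :=
  ⟨fun x => updateLaw a (κ x) (r x), by
    -- Measurability in `x` comes from expressing the law through kernel operations, the identity
    -- factor carrying `x` along to `r`.
    have h : (fun x => updateLaw a (κ x) (r x)) = fun x =>
        ((Kernel.id ×ₖ (κ ×ₖ Kernel.const X (betaLaw a))).map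
          fun w => mix w.2.2 w.2.1 (r w.1)) x := by
      funext x
      have hm : Measurable fun w : X × ProbabilityMeasure ℝ × ℝ => mix w.2.2 w.2.1 (r w.1) :=
        measurable_mix (by fun_prop) (by fun_prop) (hr.comp measurable_fst)
      rw [Kernel.map_apply _ hm, Kernel.prod_apply, Kernel.prod_apply, Kernel.id_apply,
        Kernel.const_apply, Measure.dirac_prod, Measure.map_map hm measurable_prodMk_left]
      rfl
    rw [h]
    exact Kernel.measurable _⟩

/-- The point mass at `x`. -/
noncomputable def pointMass (x : ℝ) : ProbabilityMeasure ℝ := ⟨Measure.dirac x, inferInstance⟩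

theorem measurable_pointMass : Measurable pointMass :=
  Measurable.subtype_mk Measure.measurable_dirac

/-! ### Updating a Dirichlet process -/

theorem measurable_real {A : Set ℝ} (hA : MeasurableSet A) :
    Measurable (fun p : ProbabilityMeasure ℝ => (p : Measure ℝ).real A) :=
  (measurable_eval hA).ennreal_toReal

/-- The vector of the masses of the sets `A i`. -/
noncomputable def massVector {k : ℕ} (A : Fin k → Set ℝ) (p : ProbabilityMeasure ℝ) : Fin k → ℝ :=
  fun i => (p : Measure ℝ).real (A i)

theorem measurable_massVector {k : ℕ} {A : Fin k → Set ℝ} (hA : ∀ i, MeasurableSet (A i)) :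
    Measurable (massVector A) :=
  measurable_pi_lambda _ fun i => measurable_real (hA i)

theorem sum_real_partition {P₀ : Measure ℝ} [IsProbabilityMeasure P₀] {k : ℕ} {A : Fin k → Set ℝ}
    (hA : ∀ i, MeasurableSet (A i)) (hd : Pairwise fun i j => Disjoint (A i) (A j))
    (hu : ⋃ i, A i = univ) : ∑ i, P₀.real (A i) = 1 := by
  rw [← measureReal_iUnion_fintype hd hA, hu, probReal_univ]

/-- If z are the gammas behind the Dirichlet vector, S is their sum and g an independent
exponential, then mixing z / S with the `j`-th unit vector in proportions S : g amounts to adding g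
to `z j` and normalising again. -/
theorem map_updateLaw_eq_dirichlet {k : ℕ} {a : Fin k → ℝ} (ha : ∀ i, 0 ≤ a i)
    (hpos : 0 < ∑ i, a i) {D : Measure (ProbabilityMeasure ℝ)} [IsProbabilityMeasure D]
    {A : Fin k → Set ℝ} (hA : ∀ i, MeasurableSet (A i))
    (hD : D.map (massVector A) = dirichlet a) (j : Fin k)
    {r : ProbabilityMeasure ℝ}
    (hr : ∀ i, (r : Measure ℝ).real (A i) = (Pi.single j 1 : Fin k → ℝ) i) :
    (updateLaw (∑ i, a i) D r).map (massVector A) =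
      dirichlet fun i => a i + (Pi.single j 1 : Fin k → ℝ) i := by
  have hvec := measurable_massVector hA
  have hadd : Measurable fun (w : (Fin k → ℝ) × ℝ) i => w.1 i + (Pi.single j w.2 : Fin k → ℝ) i :=
    measurable_pi_lambda _ fun i => by
      by_cases hij : i = j
      · subst hij; simp only [Pi.single_eq_same]; fun_prop
      · simp only [Pi.single_eq_of_ne hij]; fun_prop
  refine Measure.ext_of_lintegral _ fun f hf => ?_
  let H : (Fin k → ℝ) × ℝ × ℝ → ENNReal := fun w =>
    f fun i => w.2.1 / (w.2.1 + w.2.2) * w.1 i +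
      (1 - w.2.1 / (w.2.1 + w.2.2)) * (Pi.single j 1 : Fin k → ℝ) i
  have hH : Measurable H := by
    refine hf.comp (measurable_pi_lambda _ fun i => ?_)
    fun_prop
  -- Almost surely the weight lies in [0, 1], so the clipping in `mix` is inactive.
  have hgood : ∀ᵐ w ∂(gammaOne (∑ i, a i)).prod (gammaOne 1), 0 < w.1 ∧ 0 ≤ w.2 := by
    have h1 := (Measure.quasiMeasurePreserving_fst (ν := gammaOne 1)).ae (ae_pos_gammaOne hpos)
    have h2 := (Measure.quasiMeasurePreserving_snd (μ := gammaOne (∑ i, a i))).ae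
      (ae_nonneg_gammaOne 1)
    filter_upwards [h1, h2] with w h1 h2 using ⟨h1, h2⟩
  calc ∫⁻ y, f y ∂(updateLaw (∑ i, a i) D r).map (massVector A)
      = ∫⁻ p, ∫⁻ w, H (massVector A p, w)
          ∂(gammaOne (∑ i, a i)).prod (gammaOne 1) ∂D := by
        rw [lintegral_map hf hvec, lintegral_updateLaw _ _ _ (F := fun p => f (massVector A p))
          (hf.comp hvec)]
        refine lintegral_congr fun p => lintegral_congr_ae ?_
        filter_upwards [hgood] with w hw
        have h1 : 0 < w.1 + w.2 := by linarith [hw.1, hw.2]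
        have h2 : w.1 / (w.1 + w.2) ≤ 1 := (div_le_one h1).2 (by linarith [hw.2])
        simp only [H]
        congr 1
        funext i
        rw [massVector, mix_real (div_nonneg hw.1.le h1.le) h2, hr, massVector]
    _ = ∫⁻ y, ∫⁻ w, H (y, w) ∂(gammaOne (∑ i, a i)).prod (gammaOne 1) ∂dirichlet a := by
        rw [← hD, lintegral_map hH.lintegral_prod_right' hvec]
    _ = ∫⁻ y, ∫⁻ s, ∫⁻ g, H (y, s, g) ∂gammaOne 1 ∂gammaOne (∑ i, a i) ∂dirichlet a := by
        refine lintegral_congr fun y => ?_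
        exact lintegral_prod _ (hH.comp measurable_prodMk_left).aemeasurable
    _ = ∫⁻ v, ∫⁻ g, H (v.1, v.2, g) ∂gammaOne 1 ∂(dirichlet a).prod (gammaOne (∑ i, a i)) := by
        have hm : Measurable fun v : ((Fin k → ℝ) × ℝ) × ℝ => H (v.1.1, v.1.2, v.2) :=
          hH.comp (by fun_prop)
        rw [lintegral_prod _ hm.lintegral_prod_right'.aemeasurable]
    -- The independent pair (ratios, total) is realised by a single gamma vector.
    _ = ∫⁻ z, ∫⁻ g, H (fun i => z i / ∑ j, z j, ∑ j, z j, g) ∂gammaOne 1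
          ∂Measure.pi fun i => gammaOne (a i) := by
        have hm : Measurable fun v : ((Fin k → ℝ) × ℝ) × ℝ => H (v.1.1, v.1.2, v.2) :=
          hH.comp (by fun_prop)
        rw [← map_normalize_sum ha, lintegral_map hm.lintegral_prod_right' (by fun_prop)]
    _ = ∫⁻ z, ∫⁻ g, f (fun i => (z i + (Pi.single j g : Fin k → ℝ) i) /
          ∑ l, (z l + (Pi.single j g : Fin k → ℝ) l)) ∂gammaOne 1
          ∂Measure.pi fun i => gammaOne (a i) := by
        -- The total must be nonzero for it to cancel against the denominators of the ratios.
        have hS : ∀ᵐ z ∂Measure.pi fun i => gammaOne (a i), 0 < ∑ i, z i := by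
          have h := congrArg Measure.snd (map_normalize_sum ha)
          rw [Measure.snd_prod, Measure.snd, Measure.map_map measurable_snd (by fun_prop)] at h
          have h' := ae_pos_gammaOne hpos
          rw [← h] at h'
          exact ae_of_ae_map (by fun_prop) h'
        refine lintegral_congr_ae ?_
        filter_upwards [hS] with z hz
        refine lintegral_congr_ae ?_
        filter_upwards [ae_nonneg_gammaOne 1] with g hg
        simp only [H]
        congr 1
        funext i
        rw [Finset.sum_add_distrib, Finset.sum_pi_single']
        simp only [Finset.mem_univ, if_true]
        have h1 : ∑ j, z j + g ≠ 0 := by linarith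
        by_cases hij : i = j
        · subst hij
          simp only [Pi.single_eq_same]
          field_simp
          ring
        · simp only [Pi.single_eq_of_ne hij]
          field_simp
          ring
    _ = ∫⁻ y, f y ∂dirichlet fun i => a i + (Pi.single j 1 : Fin k → ℝ) i := by
        rw [dirichlet, lintegral_map hf measurable_normalize, ← map_add_single_pi_gammaOne ha,
          lintegral_map (f := fun z : Fin k → ℝ => f fun i => z i / ∑ j, z j)
            (hf.comp measurable_normalize) hadd, lintegral_prod]
        exact ((hf.comp measurable_normalize).comp hadd).aemeasurable

theorem pointMass_real_partition {k : ℕ} {A : Fin k → Set ℝ} (hA : ∀ i, MeasurableSet (A i))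
    (hd : Pairwise fun i j => Disjoint (A i) (A j)) {x : ℝ} {j : Fin k} (hx : x ∈ A j)
    (i : Fin k) : (pointMass x : Measure ℝ).real (A i) = (Pi.single j 1 : Fin k → ℝ) i := by
  change (Measure.dirac x).real (A i) = _
  rw [measureReal_def, Measure.dirac_apply' _ (hA i)]
  by_cases hij : i = j
  · subst hij
    simp [hx]
  · have : x ∉ A i := fun h => (hd hij).le_bot ⟨h, hx⟩
    simp [this, hij]

theorem IsDirichletProcess.map_updateLaw {α : ℝ} (hα : 0 < α) {P₀ : Measure ℝ}
    [IsProbabilityMeasure P₀] {D : Measure (ProbabilityMeasure ℝ)}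
    (hD : IsDirichletProcess α P₀ D) {k : ℕ} {A : Fin k → Set ℝ}
    (hA : ∀ i, MeasurableSet (A i)) (hd : Pairwise fun i j => Disjoint (A i) (A j))
    (hu : ⋃ i, A i = univ) {x : ℝ} {j : Fin k} (hx : x ∈ A j) :
    (updateLaw α D (pointMass x)).map (massVector A) =
      dirichlet fun i => α * P₀.real (A i) + (Pi.single j 1 : Fin k → ℝ) i := by
  have := hD.isProbabilityMeasure
  have hsum : ∑ i, α * P₀.real (A i) = α := by
    rw [← Finset.mul_sum, sum_real_partition hA hd hu, mul_one]
  have := map_updateLaw_eq_dirichlet (fun i => mul_nonneg hα.le measureReal_nonneg)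
    (by rwa [hsum]) hA (hD.hasLaw_partition k A hA hd hu).map_eq j
    (pointMass_real_partition hA hd hx)
  rwa [hsum] at this

/-- Exactly one cell of any partition contains `x`, so exactly one Dirichlet parameter grows by one.
The hypothesis `h` involves only the products α' P₁(A), the parameters of the new process. -/
theorem IsDirichletProcess.updateLaw {α : ℝ} (hα : 0 < α) {P₀ : Measure ℝ}
    [IsProbabilityMeasure P₀] {D : Measure (ProbabilityMeasure ℝ)}
    (hD : IsDirichletProcess α P₀ D) (x : ℝ) {α' : ℝ} {P₁ : Measure ℝ}
    (h : ∀ A, MeasurableSet A → α' * P₁.real A = α * P₀.real A + (Measure.dirac x).real A) :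
    IsDirichletProcess α' P₁ (updateLaw α D (pointMass x)) := by
  have := hD.isProbabilityMeasure
  refine ⟨inferInstance, fun k A hA hd hu => ⟨?_, ?_⟩⟩
  · exact (measurable_massVector hA).aemeasurable
  · obtain ⟨j, hx⟩ : ∃ j, x ∈ A j := mem_iUnion.1 (hu ▸ mem_univ x)
    refine (hD.map_updateLaw hα hA hd hu hx).trans ?_
    congr 1
    funext i
    rw [h _ (hA i)]
    congr 1
    exact (pointMass_real_partition hA hd hx i).symm

/-! ### Finite-dimensional distributions -/

/-- The σ-algebra on probability measures is pulled back from the product over all Borel sets under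
evaluation, and a finite measure on a product is determined by its finite marginals. -/
theorem ext_of_finite_masses {μ ν : Measure (ProbabilityMeasure ℝ)} [IsFiniteMeasure μ]
    [IsFiniteMeasure ν]
    (h : ∀ s : Finset {A : Set ℝ // MeasurableSet A},
      μ.map (fun (p : ProbabilityMeasure ℝ) (A : s) => (p : Measure ℝ).real A.1.1) =
        ν.map (fun (p : ProbabilityMeasure ℝ) (A : s) => (p : Measure ℝ).real A.1.1)) : μ = ν := by
  let ev : ProbabilityMeasure ℝ → {A : Set ℝ // MeasurableSet A} → ℝ :=
    fun p A => (p : Measure ℝ).real A.1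
  have hev : Measurable ev := measurable_pi_lambda _ fun A => measurable_real A.2
  have hmap : μ.map ev = ν.map ev := by
    have hP : ∀ s : Finset {A : Set ℝ // MeasurableSet A},
        IsFiniteMeasure ((ν.map ev).map s.restrict) := fun s => inferInstance
    refine IsProjectiveLimit.unique (P := fun s => (ν.map ev).map s.restrict) (fun s => ?_)
      fun s => rfl
    have hs : Measurable (s.restrict (π := fun _ => ℝ)) := by fun_prop
    change (μ.map ev).map s.restrict = (ν.map ev).map s.restrict
    rw [Measure.map_map hs hev, Measure.map_map hs hev]
    exact h s
  have hcoe : @Measurable _ _ (MeasurableSpace.comap ev inferInstance) _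
      (fun p : ProbabilityMeasure ℝ => (p : Measure ℝ)) := by
    refine @Measure.measurable_of_measurable_coe _ _ _ (MeasurableSpace.comap ev inferInstance) _
      fun A hA => ?_
    have hreal : @Measurable _ _ (MeasurableSpace.comap ev inferInstance) _
        (fun p : ProbabilityMeasure ℝ => ev p ⟨A, hA⟩) :=
      (measurable_pi_apply _).comp (comap_measurable ev)
    have h := ENNReal.measurable_ofReal.comp hreal
    have heq : (ENNReal.ofReal ∘ fun p : ProbabilityMeasure ℝ => ev p ⟨A, hA⟩) =
        fun p : ProbabilityMeasure ℝ => (p : Measure ℝ) A := funext fun p => ofReal_measureReal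
    rwa [heq] at h
  ext U hU
  obtain ⟨T, hT, rfl⟩ := hcoe.comap_le U hU
  rw [← Measure.map_apply hev hT, hmap, Measure.map_apply hev hT]

/-- Points are sorted by the truth vector of their memberships in the `A i`. Some cells may be
empty, which the definition of a Dirichlet process allows. -/
theorem exists_partition {ι : Type*} [Finite ι] {A : ι → Set ℝ} (hA : ∀ i, MeasurableSet (A i)) :
    ∃ (k : ℕ) (q : ℝ → Fin k), Measurable q ∧ ∀ i, ∃ T : Finset (Fin k), A i = q ⁻¹' T := by
  classical
  obtain ⟨k, ⟨e⟩⟩ := Finite.exists_equiv_fin (ι → Prop)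
  refine ⟨k, fun x => e fun i => x ∈ A i, ?_, fun i => ?_⟩
  · exact (Measurable.of_discrete (f := e)).comp (measurable_pi_lambda _ fun i => (hA i).mem)
  · refine ⟨Finset.univ.filter fun b => e.symm b i, ?_⟩
    ext x
    simp

/-- The masses of the cells of a finite partition, size-biased by the mass of one cell. -/
theorem IsDirichletProcess.setLIntegral_massVector {α : ℝ} (hα : 0 < α) {P₀ : Measure ℝ}
    [IsProbabilityMeasure P₀] {D : Measure (ProbabilityMeasure ℝ)}
    (hD : IsDirichletProcess α P₀ D) {k : ℕ} {A : Fin k → Set ℝ}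
    (hA : ∀ i, MeasurableSet (A i)) (hd : Pairwise fun i j => Disjoint (A i) (A j))
    (hu : ⋃ i, A i = univ) (j : Fin k) {E : Set (Fin k → ℝ)} (hE : MeasurableSet E) :
    ∫⁻ p in massVector A ⁻¹' E, (p : Measure ℝ) (A j) ∂D =
      ∫⁻ x in A j, SymDP.updateLaw α D (pointMass x) (massVector A ⁻¹' E) ∂P₀ := by
  have hvec := measurable_massVector hA
  have hlaw : D.map (massVector A) = dirichlet fun i => α * P₀.real (A i) :=
    (hD.hasLaw_partition k A hA hd hu).map_eq
  have hsum : ∑ i, α * P₀.real (A i) = α := by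
    rw [← Finset.mul_sum, sum_real_partition hA hd hu, mul_one]
  have h1 : ∫⁻ p in massVector A ⁻¹' E, (p : Measure ℝ) (A j) ∂D =
      ∫⁻ y in E, ENNReal.ofReal (y j) ∂dirichlet fun i => α * P₀.real (A i) := by
    rw [← hlaw, setLIntegral_map hE (by fun_prop) hvec]
    exact lintegral_congr fun p => (ofReal_measureReal (μ := (p : Measure ℝ))).symm
  -- Within the cell `A j` the updated law of the mass vector does not depend on `x`, so the
  -- integrand is constant.
  have h2 : ∫⁻ x in A j, SymDP.updateLaw α D (pointMass x) (massVector A ⁻¹' E) ∂P₀ =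
      dirichlet (fun i => α * P₀.real (A i) + (Pi.single j 1 : Fin k → ℝ) i) E * P₀ (A j) := by
    rw [← setLIntegral_const]
    refine setLIntegral_congr_fun (hA j) fun x hx => ?_
    rw [← hD.map_updateLaw hα hA hd hu hx, Measure.map_apply hvec hE]
  have h3 := setLIntegral_dirichlet
    (fun i => mul_nonneg hα.le (measureReal_nonneg (μ := P₀) (s := A i))) j hE
  rw [hsum, ENNReal.ofReal_mul hα.le, ofReal_measureReal, mul_assoc] at h3
  rw [h1, h2, mul_comm]
  exact (ENNReal.mul_right_inj (by simpa using hα) ENNReal.ofReal_ne_top).1 h3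

/-! ### Sampling one variable from a Dirichlet process -/

/-- The kernel sending `p` to `p` itself. -/
noncomputable def sampleKernel : Kernel (ProbabilityMeasure ℝ) ℝ :=
  ⟨fun p => (p : Measure ℝ), measurable_subtype_coe⟩

instance : IsMarkovKernel sampleKernel := ⟨fun p => p.2⟩

instance {X : Type*} [MeasurableSpace X] (a : ℝ) (κ : Kernel X (ProbabilityMeasure ℝ))
    [IsMarkovKernel κ] (r : X → ProbabilityMeasure ℝ) (hr : Measurable r) :
    IsMarkovKernel (updateKernel a κ r hr) :=
  ⟨fun x => inferInstanceAs (IsProbabilityMeasure (updateLaw a (κ x) (r x)))⟩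

theorem measurable_lintegral_sample {F : ProbabilityMeasure ℝ → ℝ → ENNReal}
    (hF : Measurable (Function.uncurry F)) :
    Measurable fun p : ProbabilityMeasure ℝ => ∫⁻ x, F p x ∂(p : Measure ℝ) :=
  Measurable.lintegral_kernel_prod_right' (κ := sampleKernel) hF

/-- This is the Bayes identity on rectangles. For fixed `C` both sides are finite measures in `U`,
so finite families of masses suffice; a partition refining the family and `C` reduces the claim to a
sum over the cells of `C`. -/
theorem IsDirichletProcess.setLIntegral_eval {α : ℝ} (hα : 0 < α) {P₀ : Measure ℝ}
    [IsProbabilityMeasure P₀] {D : Measure (ProbabilityMeasure ℝ)} [IsProbabilityMeasure D]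
    (hD : IsDirichletProcess α P₀ D) {C : Set ℝ} (hC : MeasurableSet C)
    {U : Set (ProbabilityMeasure ℝ)} (hU : MeasurableSet U) :
    ∫⁻ p in U, (p : Measure ℝ) C ∂D =
      ∫⁻ x in C, updateKernel α (Kernel.const ℝ D) pointMass measurable_pointMass x U ∂P₀ := by
  set κ := updateKernel α (Kernel.const ℝ D) pointMass measurable_pointMass with hκ
  have hfin : IsFiniteMeasure (D.withDensity fun p => (p : Measure ℝ) C) := by
    refine isFiniteMeasure_withDensity (ne_top_of_le_ne_top ENNReal.one_ne_top ?_)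
    calc ∫⁻ p, (p : Measure ℝ) C ∂D ≤ ∫⁻ _, 1 ∂D := lintegral_mono fun p => prob_le_one
      _ = 1 := by simp
  suffices h : D.withDensity (fun p => (p : Measure ℝ) C) = (P₀.restrict C).bind κ by
    rw [← withDensity_apply _ hU, h, Measure.bind_apply hU κ.aemeasurable]
  refine ext_of_finite_masses fun s => ?_
  -- The extra index `none` adjoins `C`, so that `C` too is a union of cells.
  have hs : ∀ A : Option s, MeasurableSet (A.elim C fun A => A.1.1) := by
    rintro (_ | A)
    exacts [hC, A.1.2]
  obtain ⟨k, q, hq, hT⟩ := exists_partition hs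
  choose T hT using hT
  let B : Fin k → Set ℝ := fun b => q ⁻¹' {b}
  have hB : ∀ b, MeasurableSet (B b) := fun b => hq (measurableSet_singleton b)
  have hd : Pairwise fun i j => Disjoint (B i) (B j) := fun i j hij =>
    Disjoint.preimage q (disjoint_singleton.2 hij)
  have hu : ⋃ i, B i = univ := eq_univ_of_forall fun x => mem_iUnion.2 ⟨q x, rfl⟩
  have hunion : ∀ T : Finset (Fin k), q ⁻¹' T = ⋃ b ∈ T, B b := fun T => by
    ext x
    simp [B]
  have hdT : ∀ T : Finset (Fin k), PairwiseDisjoint (T : Set (Fin k)) B := fun T i _ j _ hij =>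
    hd hij
  -- The masses of the given sets are sums of cell masses, so agreement of the laws of the cell
  -- masses is enough.
  let M : (Fin k → ℝ) → s → ℝ := fun y A => ∑ b ∈ T (some A), y b
  have hM : Measurable M := by fun_prop
  have hfac : (fun (p : ProbabilityMeasure ℝ) (A : s) => (p : Measure ℝ).real A.1.1) =
      M ∘ massVector B := by
    funext p A
    have h1 : A.1.1 = ⋃ b ∈ T (some A), B b := (hT (some A)).trans (hunion _)
    rw [h1, measureReal_biUnion_finset (hdT _) fun b _ => hB b]
    rfl
  have hvec := measurable_massVector hB
  rw [hfac, ← Measure.map_map hM hvec, ← Measure.map_map hM hvec]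
  congr 1
  ext E hE
  have hCU : C = ⋃ b ∈ T none, B b := (hT none).trans (hunion _)
  rw [Measure.map_apply hvec hE, Measure.map_apply hvec hE, withDensity_apply _ (hvec hE),
    Measure.bind_apply (hvec hE) κ.aemeasurable, hCU,
    lintegral_biUnion_finset (hdT _) fun b _ => hB b]
  simp_rw [measure_biUnion_finset (hdT (T none)) fun b _ => hB b]
  rw [lintegral_finsetSum _ fun b _ => measurable_eval (hB b)]
  exact Finset.sum_congr rfl fun b _ => hD.setLIntegral_massVector hα hB hd hu b hE

theorem IsDirichletProcess.lintegral_lintegral {α : ℝ} (hα : 0 < α) {P₀ : Measure ℝ}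
    [IsProbabilityMeasure P₀] {D : Measure (ProbabilityMeasure ℝ)}
    (hD : IsDirichletProcess α P₀ D) {F : ProbabilityMeasure ℝ → ℝ → ENNReal}
    (hF : Measurable (Function.uncurry F)) :
    ∫⁻ p, ∫⁻ x, F p x ∂(p : Measure ℝ) ∂D =
      ∫⁻ x, ∫⁻ p, F p x ∂SymDP.updateLaw α D (pointMass x) ∂P₀ := by
  have := hD.isProbabilityMeasure
  let κ := updateKernel α (Kernel.const ℝ D) pointMass measurable_pointMass
  have key : D ⊗ₘ sampleKernel = (P₀ ⊗ₘ κ).map Prod.swap := by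
    refine Measure.ext_prod fun {U C} hU hC => ?_
    rw [Measure.compProd_apply_prod hU hC, Measure.map_apply measurable_swap (hU.prod hC),
      preimage_swap_prod, Measure.compProd_apply_prod hC hU]
    exact hD.setLIntegral_eval hα hC hU
  calc ∫⁻ p, ∫⁻ x, F p x ∂(p : Measure ℝ) ∂D
      = ∫⁻ w, Function.uncurry F w ∂(D ⊗ₘ sampleKernel) :=
        (Measure.lintegral_compProd (κ := sampleKernel) hF).symm
    _ = ∫⁻ w, Function.uncurry F w.swap ∂(P₀ ⊗ₘ κ) := by
        rw [key, lintegral_map hF measurable_swap]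
    _ = _ := Measure.lintegral_compProd (hF.comp measurable_swap)

/-! ### Symmetrization -/

theorem reflect_dirac (x : ℝ) : reflect (Measure.dirac x) = Measure.dirac (-x) :=
  Measure.map_dirac' measurable_neg x

theorem symmetrize_apply (p : ProbabilityMeasure ℝ) {A : Set ℝ} (hA : MeasurableSet A) :
    (symmetrize p : Measure ℝ) A = 2⁻¹ * ((p : Measure ℝ) A + (p : Measure ℝ) (-A)) := by
  rw [← reflect_apply _ hA]
  rfl

theorem symmetrize_mix (b : ℝ) (p r : ProbabilityMeasure ℝ) :
    symmetrize (mix b p r) = mix b (symmetrize p) (symmetrize r) := by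
  refine Subtype.ext (Measure.ext fun A hA => ?_)
  change (symmetrize (mix b p r) : Measure ℝ) A = (mix b (symmetrize p) (symmetrize r) : Measure ℝ) A
  rw [symmetrize_apply _ hA, mix_apply, mix_apply, mix_apply, symmetrize_apply _ hA,
    symmetrize_apply _ hA]
  ring

theorem symmetrize_pointMass_neg (x : ℝ) :
    symmetrize (pointMass (-x)) = symmetrize (pointMass x) := by
  refine Subtype.ext ?_
  change (2 : ENNReal)⁻¹ • (Measure.dirac (-x) + reflect (Measure.dirac (-x))) =
    (2 : ENNReal)⁻¹ • (Measure.dirac x + reflect (Measure.dirac x))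
  rw [reflect_dirac, reflect_dirac, neg_neg, add_comm]

theorem lintegral_symmetrize (p : ProbabilityMeasure ℝ) {f : ℝ → ENNReal} (hf : Measurable f) :
    ∫⁻ x, f x ∂(symmetrize p : Measure ℝ) =
      2⁻¹ * (∫⁻ x, f x ∂(p : Measure ℝ) + ∫⁻ x, f (-x) ∂(p : Measure ℝ)) := by
  change ∫⁻ x, f x ∂((2 : ENNReal)⁻¹ • ((p : Measure ℝ) + reflect p)) = _
  rw [lintegral_smul_measure, lintegral_add_measure, reflect, lintegral_map hf measurable_neg,
    smul_eq_mul]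

/-- Symmetrization is affine, and the random weight is untouched by it. -/
theorem map_symmetrize_updateLaw (a : ℝ) (D : Measure (ProbabilityMeasure ℝ))
    [IsProbabilityMeasure D] (r : ProbabilityMeasure ℝ) :
    (updateLaw a D r).map symmetrize = updateLaw a (D.map symmetrize) (symmetrize r) := by
  have hw : Measurable fun w : ℝ × ℝ => w.1 / (w.1 + w.2) := by fun_prop
  have : IsProbabilityMeasure (D.map symmetrize) :=
    Measure.isProbabilityMeasure_map measurable_symmetrize.aemeasurable
  refine Measure.ext_of_lintegral _ fun f hf => ?_
  rw [lintegral_map hf measurable_symmetrize, lintegral_updateLaw _ _ _ hf,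
    lintegral_updateLaw _ _ _ (F := fun p => f (symmetrize p)) (hf.comp measurable_symmetrize),
    lintegral_map _ measurable_symmetrize]
  · simp_rw [symmetrize_mix]
  · have : Measurable fun v : ProbabilityMeasure ℝ × ℝ × ℝ =>
        f (mix (v.2.1 / (v.2.1 + v.2.2)) v.1 (symmetrize r)) :=
      hf.comp (measurable_mix (hw.comp measurable_snd) measurable_fst measurable_const)
    exact this.lintegral_prod_right'

theorem IsSymDirichletProcess.isProbabilityMeasure {α : ℝ} {P₀ : Measure ℝ}
    {Q : Measure (ProbabilityMeasure ℝ)} (hQ : IsSymDirichletProcess α P₀ Q) :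
    IsProbabilityMeasure Q := by
  obtain ⟨D, hD, rfl⟩ := hQ
  have := hD.isProbabilityMeasure
  exact Measure.isProbabilityMeasure_map measurable_symmetrize.aemeasurable

theorem IsSymDirichletProcess.updateLaw {α : ℝ} (hα : 0 < α) {P₀ : Measure ℝ}
    [IsProbabilityMeasure P₀] {Q : Measure (ProbabilityMeasure ℝ)}
    (hQ : IsSymDirichletProcess α P₀ Q) (x : ℝ) {α' : ℝ} {P₁ : Measure ℝ}
    (h : ∀ A, MeasurableSet A → α' * P₁.real A = α * P₀.real A + (Measure.dirac x).real A) :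
    IsSymDirichletProcess α' P₁ (updateLaw α Q (symmetrize (pointMass x))) := by
  obtain ⟨D, hD, rfl⟩ := hQ
  have := hD.isProbabilityMeasure
  exact ⟨_, hD.updateLaw hα x h, (map_symmetrize_updateLaw _ _ _).symm⟩

theorem measurable_lintegral_updateLaw {X : Type*} [MeasurableSpace X] (a : ℝ)
    (κ : Kernel X (ProbabilityMeasure ℝ)) [IsMarkovKernel κ] {r : X → ProbabilityMeasure ℝ}
    (hr : Measurable r) {F : ProbabilityMeasure ℝ → X → ENNReal}
    (hF : Measurable (Function.uncurry F)) :
    Measurable fun x => ∫⁻ p, F p x ∂updateLaw a (κ x) (r x) :=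
  Measurable.lintegral_kernel_prod_right' (κ := updateKernel a κ r hr) (hF.comp measurable_swap)

/-- A draw from `symmetrize p` is x or -x with equal weights, x being drawn from p. The
unsymmetrized identity applies to each half, and the two updates agree after symmetrization. -/
theorem IsSymDirichletProcess.lintegral_lintegral {α : ℝ} (hα : 0 < α) {P₀ : Measure ℝ}
    [IsProbabilityMeasure P₀] {Q : Measure (ProbabilityMeasure ℝ)}
    (hQ : IsSymDirichletProcess α P₀ Q) {F : ProbabilityMeasure ℝ → ℝ → ENNReal}
    (hF : Measurable (Function.uncurry F)) :
    ∫⁻ p, ∫⁻ x, F p x ∂(p : Measure ℝ) ∂Q =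
      ∫⁻ x, ∫⁻ p, F p x ∂SymDP.updateLaw α Q (symmetrize (pointMass x))
        ∂((2 : ENNReal)⁻¹ • (P₀ + reflect P₀)) := by
  have hQP := hQ.isProbabilityMeasure
  obtain ⟨D, hD, rfl⟩ := hQ
  have := hD.isProbabilityMeasure
  have hG : Measurable fun x => ∫⁻ p, F p x
      ∂SymDP.updateLaw α (D.map symmetrize) (symmetrize (pointMass x)) :=
    measurable_lintegral_updateLaw α (Kernel.const ℝ (D.map symmetrize))
      (measurable_symmetrize.comp measurable_pointMass) hF
  have hFx : ∀ x, Measurable fun p => F p x := fun x => hF.comp measurable_prodMk_right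
  have hFp : ∀ p, Measurable (F p) := fun p => hF.comp measurable_prodMk_left
  have hF1 : Measurable fun w : ProbabilityMeasure ℝ × ℝ => F (symmetrize w.1) w.2 :=
    hF.comp ((measurable_symmetrize.comp measurable_fst).prodMk measurable_snd)
  have hF2 : Measurable fun w : ProbabilityMeasure ℝ × ℝ => F (symmetrize w.1) (-w.2) :=
    hF.comp ((measurable_symmetrize.comp measurable_fst).prodMk measurable_snd.neg)
  have hstep : ∀ x, ∫⁻ p, F p x
      ∂SymDP.updateLaw α (D.map symmetrize) (symmetrize (pointMass x)) =
      ∫⁻ p, F (symmetrize p) x ∂SymDP.updateLaw α D (pointMass x) := by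
    intro x
    rw [← map_symmetrize_updateLaw, lintegral_map (hFx x) measurable_symmetrize]
  -- For the reflected half the observed value is -x while the underlying draw is x;
  -- `symmetrize_pointMass_neg` reconciles the two.
  have hstep' : ∀ x, ∫⁻ p, F p (-x)
      ∂SymDP.updateLaw α (D.map symmetrize) (symmetrize (pointMass (-x))) =
      ∫⁻ p, F (symmetrize p) (-x) ∂SymDP.updateLaw α D (pointMass x) := by
    intro x
    rw [symmetrize_pointMass_neg, ← map_symmetrize_updateLaw,
      lintegral_map (hFx _) measurable_symmetrize]
  rw [lintegral_smul_measure, lintegral_add_measure, reflect, lintegral_map hG measurable_neg,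
    smul_eq_mul]
  simp_rw [hstep', hstep]
  have hS1 := measurable_lintegral_sample (F := fun p x => F (symmetrize p) x) hF1
  have hS2 := measurable_lintegral_sample (F := fun p x => F (symmetrize p) (-x)) hF2
  have hS12 : Measurable fun p : ProbabilityMeasure ℝ => ∫⁻ x, F (symmetrize p) x ∂(p : Measure ℝ) +
      ∫⁻ x, F (symmetrize p) (-x) ∂(p : Measure ℝ) := hS1.add hS2
  rw [← hD.lintegral_lintegral hα (F := fun p x => F (symmetrize p) x) hF1,
    ← hD.lintegral_lintegral hα (F := fun p x => F (symmetrize p) (-x)) hF2,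
    lintegral_map (measurable_lintegral_sample hF) measurable_symmetrize,
    ← lintegral_add_left hS1, ← lintegral_const_mul _ hS12]
  exact lintegral_congr fun p => lintegral_symmetrize p (hFp _)

/-! ### Sampling several variables from a symmetrized Dirichlet process -/

theorem measurable_snoc {n : ℕ} :
    Measurable fun w : (Fin n → ℝ) × ℝ => (Fin.snoc w.1 w.2 : Fin (n + 1) → ℝ) := by
  refine measurable_pi_lambda _ fun i => ?_
  refine Fin.lastCases ?_ (fun j => ?_) i
  · simp only [Fin.snoc_last]; fun_prop
  · simp only [Fin.snoc_castSucc]; fun_prop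

instance (n : ℕ) : IsMarkovKernel (iidKernel n) :=
  ⟨fun p => inferInstanceAs (IsProbabilityMeasure (Measure.pi fun _ : Fin n => (p : Measure ℝ)))⟩

theorem lintegral_iidKernel_succ {n : ℕ} (p : ProbabilityMeasure ℝ)
    {F : (Fin (n + 1) → ℝ) → ENNReal} (hF : Measurable F) :
    ∫⁻ t, F t ∂iidKernel (n + 1) p =
      ∫⁻ s, ∫⁻ x, F (Fin.snoc s x) ∂(p : Measure ℝ) ∂iidKernel n p := by
  have hmp := measurePreserving_piFinSuccAbove (fun _ : Fin (n + 1) => (p : Measure ℝ)) (Fin.last n)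
  have hG : Measurable fun w : ℝ × (Fin n → ℝ) => F (Fin.snoc w.2 w.1) :=
    hF.comp (measurable_snoc.comp measurable_swap)
  have h := hmp.lintegral_comp hG
  rw [lintegral_prod_symm _ hG.aemeasurable] at h
  refine Eq.trans (lintegral_congr fun t => ?_) h
  congr 1
  funext i
  refine Fin.lastCases ?_ (fun j => ?_) i
  · simp [MeasurableEquiv.piFinSuccAbove]
  · simp [MeasurableEquiv.piFinSuccAbove, Fin.init]

/-- Without the normalisation, a new observation simply adds its point mass, which is the form
required by the update lemmas. -/
theorem posteriorMean_real {α : ℝ} (hα : 0 < α) (P₀ : Measure ℝ) [IsProbabilityMeasure P₀]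
    {n : ℕ} (t : Fin n → ℝ) (A : Set ℝ) :
    (α + n) * (posteriorMean α P₀ t).real A =
      α * P₀.real A + ∑ i, (Measure.dirac (t i)).real A := by
  have hpos : 0 < α + n := by positivity
  simp only [measureReal_def, posteriorMean, Measure.smul_apply, Measure.add_apply,
    Measure.coe_finsetSum, Finset.sum_apply, smul_eq_mul, ENNReal.toReal_mul, ENNReal.toReal_inv]
  rw [ENNReal.toReal_add (ENNReal.mul_ne_top ENNReal.ofReal_ne_top (measure_ne_top _ _))
    (ENNReal.sum_ne_top.2 fun i _ => measure_ne_top _ _), ENNReal.toReal_mul,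
    ENNReal.toReal_sum fun i _ => measure_ne_top _ _, ENNReal.toReal_ofReal hα.le,
    ENNReal.toReal_ofReal hpos.le, mul_inv_cancel_left₀ hpos.ne']

theorem posteriorMean_zero {α : ℝ} (hα : 0 < α) (P₀ : Measure ℝ) (t : Fin 0 → ℝ) :
    posteriorMean α P₀ t = P₀ := by
  simp only [posteriorMean, Finset.univ_eq_empty, Finset.sum_empty, add_zero, Nat.cast_zero]
  rw [smul_smul, ENNReal.inv_mul_cancel (by simpa using hα) ENNReal.ofReal_ne_top, one_smul]

theorem predictive_eq {α : ℝ} (hα : 0 < α) (P₀ : Measure ℝ) {n : ℕ} (t : Fin n → ℝ) :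
    predictive α P₀ t =
      (2 : ENNReal)⁻¹ • (posteriorMean α P₀ t + reflect (posteriorMean α P₀ t)) := by
  have hpos : 0 < α + n := by positivity
  have h2 : (2 : ENNReal)⁻¹ = ENNReal.ofReal 2⁻¹ := by
    rw [ENNReal.ofReal_inv_of_pos two_pos, ENNReal.ofReal_ofNat]
  have hc : ENNReal.ofReal (1 / (2 * (α + n))) =
      (2 : ENNReal)⁻¹ * (ENNReal.ofReal (α + n))⁻¹ := by
    rw [h2, ← ENNReal.ofReal_inv_of_pos hpos, ← ENNReal.ofReal_mul (by positivity)]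
    congr 1
    field_simp
  have hd : ENNReal.ofReal (α / (2 * (α + n))) =
      (2 : ENNReal)⁻¹ * (ENNReal.ofReal (α + n))⁻¹ * ENNReal.ofReal α := by
    rw [← hc, ← ENNReal.ofReal_mul (by positivity)]
    congr 1
    field_simp
  have hdirac : ∀ x : ℝ, ∀ A : Set ℝ, MeasurableSet A →
      Measure.dirac x (-A) = Measure.dirac (-x) A := fun x A hA => by
    rw [← reflect_dirac, reflect_apply _ hA]
  ext A hA
  simp only [predictive, posteriorMean, Measure.smul_apply, Measure.add_apply, reflect_apply _ hA,
    Measure.coe_finsetSum, Finset.sum_apply, smul_eq_mul, hc, hd, hdirac _ _ hA,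
    Finset.sum_add_distrib]
  ring

/-- `κ` is a version of the conditional law of `p` given `n` independent draws from `p`, when `p`
has law `Q`. -/
def IsPosterior (Q : Measure (ProbabilityMeasure ℝ)) {n : ℕ}
    (κ : Kernel (Fin n → ℝ) (ProbabilityMeasure ℝ)) : Prop :=
  ∀ F : ProbabilityMeasure ℝ → (Fin n → ℝ) → ENNReal, Measurable (Function.uncurry F) →
    ∫⁻ p, ∫⁻ t, F p t ∂iidKernel n p ∂Q = ∫⁻ t, ∫⁻ p, F p t ∂κ t ∂Q.bind (iidKernel n)

/-- Given the first `n` draws, p follows the symmetrized process `κ s`; the one-draw identity for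
that process handles the last draw. -/
theorem lintegral_iidKernel_succ_of_isPosterior {α : ℝ} (hα : 0 < α) {P₀ : Measure ℝ}
    [IsProbabilityMeasure P₀] {Q : Measure (ProbabilityMeasure ℝ)} {n : ℕ}
    {κ : Kernel (Fin n → ℝ) (ProbabilityMeasure ℝ)}
    (hκ : ∀ t, IsSymDirichletProcess (α + n) (posteriorMean α P₀ t) (κ t))
    (hQ : IsPosterior Q κ) {F : ProbabilityMeasure ℝ → (Fin (n + 1) → ℝ) → ENNReal}
    (hF : Measurable (Function.uncurry F)) :
    ∫⁻ p, ∫⁻ t, F p t ∂iidKernel (n + 1) p ∂Q =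
      ∫⁻ s, ∫⁻ x, ∫⁻ p, F p (Fin.snoc s x)
        ∂updateLaw (α + n) (κ s) (symmetrize (pointMass x)) ∂predictive α P₀ s
        ∂Q.bind (iidKernel n) := by
  have hFs : Measurable fun w : (ProbabilityMeasure ℝ × (Fin n → ℝ)) × ℝ =>
      F w.1.1 (Fin.snoc w.1.2 w.2) :=
    hF.comp ((measurable_fst.comp measurable_fst).prodMk
      (measurable_snoc.comp ((measurable_snd.comp measurable_fst).prodMk measurable_snd)))
  have hG : Measurable (Function.uncurry fun (p : ProbabilityMeasure ℝ) (s : Fin n → ℝ) =>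
      ∫⁻ x, F p (Fin.snoc s x) ∂(p : Measure ℝ)) :=
    Measurable.lintegral_kernel_prod_right'
      (κ := sampleKernel.comap (Prod.fst : ProbabilityMeasure ℝ × (Fin n → ℝ) → _)
        measurable_fst) hFs
  calc ∫⁻ p, ∫⁻ t, F p t ∂iidKernel (n + 1) p ∂Q
      = ∫⁻ p, ∫⁻ s, ∫⁻ x, F p (Fin.snoc s x) ∂(p : Measure ℝ) ∂iidKernel n p ∂Q :=
        lintegral_congr fun p => lintegral_iidKernel_succ p (hF.comp measurable_prodMk_left)
    _ = ∫⁻ s, ∫⁻ p, ∫⁻ x, F p (Fin.snoc s x) ∂(p : Measure ℝ) ∂κ s ∂Q.bind (iidKernel n) :=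
        hQ _ hG
    _ = _ := by
        refine lintegral_congr fun s => ?_
        have := isProbabilityMeasure_posteriorMean hα P₀ s
        rw [predictive_eq hα]
        refine (hκ s).lintegral_lintegral (by positivity) (F := fun p x => F p (Fin.snoc s x)) ?_
        exact hFs.comp (by fun_prop : Measurable fun w : ProbabilityMeasure ℝ × ℝ => ((w.1, s), w.2))

/-- Induction on `n`: the posterior after the first `n` draws acts as prior for the last one. With
no draws the posterior is `Q` itself. -/
theorem exists_isPosterior {α : ℝ} (hα : 0 < α) {P₀ : Measure ℝ} [IsProbabilityMeasure P₀]
    {Q : Measure (ProbabilityMeasure ℝ)} (hQ : IsSymDirichletProcess α P₀ Q) (n : ℕ) :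
    ∃ κ : Kernel (Fin n → ℝ) (ProbabilityMeasure ℝ),
      (∀ t, IsSymDirichletProcess (α + n) (posteriorMean α P₀ t) (κ t)) ∧ IsPosterior Q κ := by
  have hQP := hQ.isProbabilityMeasure
  induction n with
  | zero =>
    refine ⟨Kernel.const _ Q, fun t => ?_, fun F hF => ?_⟩
    · rw [posteriorMean_zero hα, Nat.cast_zero, add_zero]
      exact hQ
    · have h0 : ∀ (p : ProbabilityMeasure ℝ) (t : Fin 0 → ℝ), F p t = F p default := fun p t => by
        rw [Subsingleton.elim t default]
      simp [h0]
  | succ n ih =>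
    obtain ⟨κ, hκ, hpost⟩ := ih
    have hM : IsMarkovKernel κ := ⟨fun t => (hκ t).isProbabilityMeasure⟩
    have hinit : Measurable fun (t : Fin (n + 1) → ℝ) (i : Fin n) => t i.castSucc := by fun_prop
    have hr : Measurable fun t : Fin (n + 1) → ℝ => symmetrize (pointMass (t (Fin.last n))) :=
      measurable_symmetrize.comp (measurable_pointMass.comp (measurable_pi_apply _))
    let η := updateKernel (α + n) (κ.comap _ hinit) _ hr
    refine ⟨η, fun t => ?_, fun F hF => ?_⟩
    · have := isProbabilityMeasure_posteriorMean hα P₀ fun i : Fin n => t i.castSucc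
      refine (hκ fun i => t i.castSucc).updateLaw (by positivity) (t (Fin.last n)) fun A hA => ?_
      rw [posteriorMean_real hα, posteriorMean_real hα, Fin.sum_univ_castSucc, add_assoc]
    · have hη : ∀ (s : Fin n → ℝ) (x : ℝ), η (Fin.snoc s x) =
          updateLaw (α + n) (κ s) (symmetrize (pointMass x)) := by
        intro s x
        change updateLaw (α + n) (κ fun i => (Fin.snoc s x : Fin (n + 1) → ℝ) i.castSucc)
          (symmetrize (pointMass ((Fin.snoc s x : Fin (n + 1) → ℝ) (Fin.last n)))) = _
        simp
      have hG : Measurable fun t => ∫⁻ p, F p t ∂η t :=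
        Measurable.lintegral_kernel_prod_right' (κ := η) (hF.comp measurable_swap)
      -- Both sides are expanded by the same formula. On the right the integrand no longer depends
      -- on p, so the outer update law integrates to one.
      rw [lintegral_iidKernel_succ_of_isPosterior hα hκ hpost hF,
        Measure.lintegral_bind (iidKernel _).aemeasurable hG.aemeasurable,
        lintegral_iidKernel_succ_of_isPosterior hα hκ hpost
          (F := fun _ t => ∫⁻ p, F p t ∂η t) (hG.comp measurable_snd)]
      simp [hη]

/-! ### The predictive kernel and passage to conditional distributions. -/

theorem measurable_predictive (α : ℝ) (P₀ : Measure ℝ) (n : ℕ) :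
    Measurable fun t : Fin n → ℝ => predictive α P₀ t := by
  have hδ : ∀ A : Set ℝ, MeasurableSet A → Measurable fun x : ℝ => Measure.dirac x A := fun A hA =>
    (Measure.measurable_coe hA).comp Measure.measurable_dirac
  refine Measure.measurable_of_measurable_coe _ fun A hA => ?_
  simp only [predictive, Measure.add_apply, Measure.smul_apply, smul_eq_mul,
    Measure.coe_finsetSum, Finset.sum_apply]
  refine measurable_const.add (Measurable.const_mul (Finset.measurable_sum _ fun i _ => ?_) _)
  exact ((hδ A hA).comp (measurable_pi_apply i)).add
    ((hδ A hA).comp (measurable_pi_apply i).neg)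

/-- The kernel of predictive distributions. -/
noncomputable def predictiveKernel (α : ℝ) (P₀ : Measure ℝ) (n : ℕ) : Kernel (Fin n → ℝ) ℝ :=
  ⟨fun t => predictive α P₀ t, measurable_predictive α P₀ n⟩

theorem isMarkovKernel_predictiveKernel {α : ℝ} (hα : 0 < α) (P₀ : Measure ℝ)
    [IsProbabilityMeasure P₀] (n : ℕ) : IsMarkovKernel (predictiveKernel α P₀ n) := by
  refine ⟨fun t => ?_⟩
  have := isProbabilityMeasure_posteriorMean hα P₀ t
  change IsProbabilityMeasure (predictive α P₀ t)
  rw [predictive_eq hα]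
  exact (symmetrize ⟨posteriorMean α P₀ t, this⟩).2

theorem map_eq_bind_of_hasCondDistrib {Ω X Y : Type*} [MeasurableSpace Ω] [MeasurableSpace X]
    [MeasurableSpace Y] {ν : Measure Ω} {Q : Measure X} [SFinite Q] {P : Ω → X}
    {θ : Ω → Y} {κ : Kernel X Y} [IsSFiniteKernel κ] (hP : HasLaw P Q ν)
    (hθ : HasCondDistrib θ P κ ν) : ν.map θ = Q.bind κ := by
  have h := (hP.prodMk_of_hasCondDistrib hθ).map_eq
  have h' := congrArg Measure.snd h
  rwa [Measure.snd_compProd, Measure.snd_map_prodMk₀ hP.aemeasurable] at h'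

/-- The joint law of (P, θ) is `Q ⊗ₘ iidKernel n`; `IsPosterior` says, through test functions, that
swapping its factors gives the marginal of θ composed with `κ`. -/
theorem IsPosterior.hasCondDistrib {Ω : Type*} [MeasurableSpace Ω] {ν : Measure Ω}
    {Q : Measure (ProbabilityMeasure ℝ)} [IsProbabilityMeasure Q] {n : ℕ}
    {κ : Kernel (Fin n → ℝ) (ProbabilityMeasure ℝ)} [IsMarkovKernel κ] (hκ : IsPosterior Q κ)
    {P : Ω → ProbabilityMeasure ℝ} (hP : HasLaw P Q ν) {θ : Ω → Fin n → ℝ}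
    (hθ : HasCondDistrib θ P (iidKernel n) ν) : HasCondDistrib P θ κ ν := by
  have hθm := hθ.aemeasurable_snd
  refine ⟨hθm.prodMk hP.aemeasurable, Measure.ext_of_lintegral _ fun f hf => ?_⟩
  have hjoint := (hP.prodMk_of_hasCondDistrib hθ).map_eq
  have hswap : ν.map (fun ω => (θ ω, P ω)) = (Q ⊗ₘ iidKernel n).map Prod.swap := by
    rw [← hjoint, AEMeasurable.map_map_of_aemeasurable (by fun_prop)
      (hP.aemeasurable.prodMk hθm)]
    rfl
  rw [hswap, map_eq_bind_of_hasCondDistrib hP hθ, lintegral_map hf measurable_swap,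
    Measure.lintegral_compProd (f := fun w => f w.swap) (hf.comp measurable_swap),
    Measure.lintegral_compProd hf]
  exact hκ (fun p t => f (t, p)) (hf.comp measurable_swap)

end SymDP

theorem mainTheorem11 {Ω : Type*} [MeasurableSpace Ω] (ν : Measure Ω) [IsProbabilityMeasure ν]
    (α : ℝ) (hα : 0 < α) (P₀ : Measure ℝ) [IsProbabilityMeasure P₀]
    (Q : Measure (ProbabilityMeasure ℝ)) (hQ : SymDP.IsSymDirichletProcess α P₀ Q)
    (P : Ω → ProbabilityMeasure ℝ) (hP : HasLaw P Q ν) :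
    (∀ (n : ℕ) (θ : Fin n → Ω → ℝ),
      HasCondDistrib (fun ω i => θ i ω) P (SymDP.iidKernel n) ν →
      ∃ κ : Kernel (Fin n → ℝ) (ProbabilityMeasure ℝ),
        (∀ t, SymDP.IsSymDirichletProcess (α + n) (SymDP.posteriorMean α P₀ t) (κ t)) ∧
        HasCondDistrib P (fun ω i => θ i ω) κ ν) ∧
    (∀ (n : ℕ) (θ : Fin (n + 1) → Ω → ℝ),
      HasCondDistrib (fun ω i => θ i ω) P (SymDP.iidKernel (n + 1)) ν →
      ∃ κ : Kernel (Fin n → ℝ) ℝ,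
        (∀ t, κ t = SymDP.predictive α P₀ t) ∧
        HasCondDistrib (θ (Fin.last n)) (fun ω i => θ (Fin.castSucc i) ω) κ ν) := by
  have hQP := hQ.isProbabilityMeasure
  refine ⟨fun n θ hθ => ?_, fun n θ hθ => ?_⟩
  · obtain ⟨κ, hκ, hpost⟩ := SymDP.exists_isPosterior hα hQ n
    have : IsMarkovKernel κ := ⟨fun t => (hκ t).isProbabilityMeasure⟩
    exact ⟨κ, hκ, hpost.hasCondDistrib hP hθ⟩
  · obtain ⟨κ, hκ, hpost⟩ := SymDP.exists_isPosterior hα hQ n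
    have : IsMarkovKernel κ := ⟨fun t => (hκ t).isProbabilityMeasure⟩
    have := SymDP.isMarkovKernel_predictiveKernel hα P₀ n
    refine ⟨SymDP.predictiveKernel α P₀ n, fun t => rfl, ?_⟩
    have hθm := hθ.aemeasurable_snd
    have hinit : Measurable fun (t : Fin (n + 1) → ℝ) (i : Fin n) => t i.castSucc := by fun_prop
    have hsplit : Measurable fun t : Fin (n + 1) → ℝ =>
        ((fun i => t (Fin.castSucc i) : Fin n → ℝ), t (Fin.last n)) := by fun_prop
    have hθ₀ : AEMeasurable (fun ω (i : Fin n) => θ (Fin.castSucc i) ω) ν :=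
      hinit.comp_aemeasurable hθm
    have hθ₁ : AEMeasurable
        (fun ω => ((fun i => θ (Fin.castSucc i) ω : Fin n → ℝ), θ (Fin.last n) ω)) ν :=
      hsplit.comp_aemeasurable hθm
    have hlaw := SymDP.map_eq_bind_of_hasCondDistrib hP hθ
    -- For a function of the sample alone, the integral over the updated law of p is trivial, and
    -- only the predictive law of the last draw remains.
    have key : ∀ f : (Fin n → ℝ) × ℝ → ENNReal, Measurable f →
        ∫⁻ ω, f (fun i => θ (Fin.castSucc i) ω, θ (Fin.last n) ω) ∂ν =
          ∫⁻ s, ∫⁻ x, f (s, x) ∂SymDP.predictiveKernel α P₀ n s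
            ∂Q.bind (SymDP.iidKernel n) := by
      intro f hf
      have hfs : Measurable fun t : Fin (n + 1) → ℝ =>
        f (fun i => t (Fin.castSucc i), t (Fin.last n)) := hf.comp hsplit
      have h1 : ∫⁻ ω, f (fun i => θ (Fin.castSucc i) ω, θ (Fin.last n) ω) ∂ν =
          ∫⁻ t, f (fun i => t (Fin.castSucc i), t (Fin.last n))
            ∂ν.map fun ω i => θ i ω :=
        (lintegral_map' hfs.aemeasurable hθm).symm
      rw [h1, hlaw, Measure.lintegral_bind (SymDP.iidKernel _).aemeasurable
        hfs.aemeasurable, SymDP.lintegral_iidKernel_succ_of_isPosterior hα hκ hpost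
        (F := fun _ t => f (fun i => t (Fin.castSucc i), t (Fin.last n)))
        (hfs.comp measurable_snd)]
      simp only [Fin.snoc_castSucc, Fin.snoc_last, lintegral_const, measure_univ, mul_one]
      rfl
    -- Test functions ignoring the last draw identify the law of the first `n`, the predictive law
    -- having mass one.
    have hmarg : ν.map (fun ω i => θ (Fin.castSucc i) ω) = Q.bind (SymDP.iidKernel n) := by
      refine Measure.ext_of_lintegral _ fun f hf => ?_
      rw [lintegral_map' hf.aemeasurable hθ₀]
      refine (key (fun w => f w.1) (hf.comp measurable_fst)).trans ?_
      simp
    refine ⟨hθ₁, Measure.ext_of_lintegral _ fun f hf => ?_⟩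
    rw [lintegral_map' hf.aemeasurable hθ₁,
      Measure.lintegral_compProd hf, hmarg]
    exact key f hf
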